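/- **Setting.** Let $n\ge 1$ and let $A\in\mathbb R^{n\times n}$ be symmetric with zero diagonal. The Ising model $\mathcal D(A,0)$ is the distribution on $\{-1,1\}^n$ with $\Pr[Z=z]\propto\exp\big(\sum_{i<j}A_{ij}z_iz_j\big)$, and its width is $\lambda(A)=\max_i\sum_j|A_{ij}|$. For $p=(p_1,\dots,p_n)\in[0,1/2)^n$, a flipped sample is $X=(C_1Z_1,\dots,C_nZ_n)$, where $Z\sim\mathcal D(A,0)$ and $C_1,\dots,C_n\in\{-1,1\}$ are independent of $Z$ and of each other with $\Pr[C_i=-1]=p_i$. **Estimator.** For $w\in\mathbb R^{2n-1}$ let $\Pi(w)_i=w_i-w_{n-1+i}$ for $i\in[n-1]$. Put $$\sigma(q,a,x)=\frac{(1-q)e^{ax}-qe^{-ax}}{1-2q},\qquad \tau(q,a,x)=\frac{(1-q)e^{ax}+qe^{-ax}}{1-2q},$$ $$h^i(w;X)=X_nX_i\,\tau\big(p_i,-\Pi(w)_iX_n,X_i\big)\prod_{j\ne i,n}\sigma\big(p_j,-\Pi(w)_jX_n,X_j\big),$$ $$g^i(w;X)=-\frac{(1-p_n)h^i(w;X)+p_nh^i(-w;X)}{1-2p_n},\qquad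 G(w;X)=\sum_{i=1}^{n-1}g^i(w;X)\,(e^i-e^{n-1+i})\in\mathbb R^{2n-1}.$$ **Algorithm** (inputs: $\lambda>0$, $p$, step size $\eta>0$, samples $X^1,\dots,X^T$). Set $w^1_a=\lambda/(2n-1)$ for all $a\in[2n-1]$; for $t=1,\dots,T$ put $c^t=\langle w^t,G(w^t;X^t)\rangle/\lambda$ and $w^{t+1}_a=w^t_a\big(1-\eta\,G(w^t;X^t)_a+\eta c^t\big)$ for all $a$; output $\bar w=\frac1T\sum_{t=1}^Tw^t$. **Theorem.** For every $p_{\max}<1/2$ and $\lambda_0>0$ there is a constant $C>0$, depending only on $p_{\max}$ and $\lambda_0$, such that the following holds. For all $n\ge1$, all $p$ with $0\le p_i\le p_{\max}$, all $\lambda\ge\lambda_0$ and all $T\in\mathbb N$ there is a step size $\eta>0$ (depending only on $p_{\max},\lambda_0,n,p,\lambda,T$) such that for all $\varepsilon>0$ and $\delta\in(0,1)$ with $$T\ \ge\ \lambda^4\,\log(n/\delta)\,\exp(C\lambda)\,\varepsilon^{-4}$$ and every Ising model $\mathcal D(A,0)$ on $n$ variables of width $\lambda(A)\le\lambda$, the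 algorithm run on $T$ independent flipped samples of $\mathcal D(A,0)$ returns $\bar w$ such that, with probability at least $1-\delta$, $$\big|\Pi(\bar w)_i-A_{ni}\big|\le\varepsilon\qquad\text{for all } i\in[n-1].$$ -/

import Mathlib

open MeasureTheory ProbabilityTheory

noncomputable section

namespace FlipIsing

/-- Spin configurations `{-1, 1}^n`; the group `ℤˣ = {1, -1}` is the set of spins. -/
abbrev Config (n : ℕ) : Type := Fin n → ℤˣ

/-- A spin as a real number. -/
def spin (s : ℤˣ) : ℝ := ((s : ℤ) : ℝ)

/-- The unnormalized Ising weight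
`exp (∑_{i < j} A_ij z_i z_j + ∑_i θ_i z_i)`: every unordered pair is counted once. -/
def isingWeight {n : ℕ} (A : Matrix (Fin n) (Fin n) ℝ) (θ : Fin n → ℝ) (z : Config n) : ℝ :=
  Real.exp ((∑ i, ∑ j ∈ Finset.Ioi i, A i j * spin (z i) * spin (z j)) + ∑ i, θ i * spin (z i))

/-- The partition function. -/
def partitionFn {n : ℕ} (A : Matrix (Fin n) (Fin n) ℝ) (θ : Fin n → ℝ) : ℝ :=
  ∑ z : Config n, isingWeight A θ z

/-- The Ising model `D(A, θ)` as a distribution on `{-1, 1}^n`. -/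
def ising {n : ℕ} (A : Matrix (Fin n) (Fin n) ℝ) (θ : Fin n → ℝ) : Measure (Config n) :=
  ∑ z : Config n, ENNReal.ofReal (isingWeight A θ z / partitionFn A θ) • Measure.dirac z

/-- The width `max_i (∑_j |A_ij| + |θ_i|)`. -/
def width {n : ℕ} (A : Matrix (Fin n) (Fin n) ℝ) (θ : Fin n → ℝ) : ℝ :=
  ⨆ i, ((∑ j, |A i j|) + |θ i|)

/-- The distribution `Rad(q)` on `{-1, 1}`, with probability `q` of drawing `1`. -/
def rad (q : ℝ) : Measure ℤˣ :=
  ENNReal.ofReal q • Measure.dirac 1 + ENNReal.ofReal (1 - q) • Measure.dirac (-1)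

/-- The corrupted distribution: draw `Z ∼ D(A, θ)` and, independently of `Z` and of each other,
`C_i ∼ Rad(1 - p_i)`; output `X` with `X_i = C_i Z_i`. -/
def flipped {n : ℕ} (A : Matrix (Fin n) (Fin n) ℝ) (θ p : Fin n → ℝ) : Measure (Config n) :=
  ((ising A θ).prod (Measure.pi fun i => rad (1 - p i))).map fun zc i => zc.2 i * zc.1 i

/-- The coordinates `1, …, 2k+1` of `ℝ^(2k+1)`: `inl i` is the coordinate `i`,
`inr (inl i)` is the coordinate `k + i`, and `inr (inr ())` is the coordinate `2k + 1`. -/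
abbrev Coord (k : ℕ) : Type := Fin k ⊕ Fin k ⊕ Unit

/-- The map from the simplex to the `ℓ¹` ball, `w ↦ (w_i - w_{k+i})_i`. -/
def toBall {k : ℕ} (w : Coord k → ℝ) (i : Fin k) : ℝ :=
  w (Sum.inl i) - w (Sum.inr (Sum.inl i))

/-- `σ(p, a, ·)`: from a flipped `x`, an unbiased estimator of `exp (a z)`; it is
`((1 - p) f(x) - p f(-x)) / (1 - 2p)` for `f(x) = exp (a x)`. -/
def sigma (p a x : ℝ) : ℝ :=
  ((1 - p) * Real.exp (a * x) - p * Real.exp (-(a * x))) / (1 - 2 * p)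

/-- From a flipped `x`, an unbiased estimator of `z exp (a z)`; it is
`((1 - p) f(x) - p f(-x)) / (1 - 2p)` for `f(x) = x exp (a x)`. -/
def sigmaLin (p a x : ℝ) : ℝ :=
  ((1 - p) * (x * Real.exp (a * x)) - p * (-x * Real.exp (-(a * x)))) / (1 - 2 * p)

/-- The vertices are `Fin (k + 1)`; the vertex whose neighbourhood is learned is `Fin.last k`,
and the others are `i.castSucc` for `i : Fin k`. -/
def hFlip {k : ℕ} (p : Fin (k + 1) → ℝ) (i : Fin k) (w : Coord k → ℝ) (x : Config (k + 1)) : ℝ :=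
  spin (x (Fin.last k)) *
    sigmaLin (p i.castSucc) (-(toBall w i * spin (x (Fin.last k)))) (spin (x i.castSucc)) *
    ∏ j ∈ Finset.univ.erase i,
      sigma (p j.castSucc) (-(toBall w j * spin (x (Fin.last k)))) (spin (x j.castSucc))

def gFlip {k : ℕ} (p : Fin (k + 1) → ℝ) (i : Fin k) (w : Coord k → ℝ) (x : Config (k + 1)) : ℝ :=
  -(((1 - p (Fin.last k)) * hFlip p i w x + p (Fin.last k) * hFlip p i (-w) x) /
    (1 - 2 * p (Fin.last k)))

/-- The gradient estimator `∑_i g^i (e^i - e^{k+i})`. -/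
def GFlip {k : ℕ} (p : Fin (k + 1) → ℝ) (w : Coord k → ℝ) (x : Config (k + 1)) : Coord k → ℝ
  | Sum.inl i => gFlip p i w x
  | Sum.inr (Sum.inl i) => -gFlip p i w x
  | Sum.inr (Sum.inr _) => 0

/-- One update: `w_a ↦ w_a (1 - η G_a + η ⟨w, G⟩ / lam)`. -/
def smgStep {k : ℕ} (p : Fin (k + 1) → ℝ) (lam η : ℝ) (w : Coord k → ℝ) (x : Config (k + 1)) :
    Coord k → ℝ :=
  fun a => w a * (1 - η * GFlip p w x a + η * ((∑ b, w b * GFlip p w x b) / lam))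

/-- The iterates: `smgIter … x t` is `w^{t+1}`, starting from the constant vector
`w^1 = lam / (2k + 1)` and consuming one sample per round while there are any. -/
def smgIter {k T : ℕ} (p : Fin (k + 1) → ℝ) (lam η : ℝ) (x : Fin T → Config (k + 1)) :
    ℕ → Coord k → ℝ
  | 0 => fun _ => lam / (2 * k + 1)
  | t + 1 =>
    if h : t < T then smgStep p lam η (smgIter p lam η x t) (x ⟨t, h⟩)
    else smgIter p lam η x t

/-- The output `(1/T) ∑_{t=1}^T w^t` of the algorithm on `T` samples. -/
def smgOutput {k T : ℕ} (p : Fin (k + 1) → ℝ) (lam η : ℝ) (x : Fin T → Config (k + 1)) :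
    Coord k → ℝ :=
  fun a => (1 / (T : ℝ)) * ∑ t ∈ Finset.range T, smgIter p lam η x t a

end FlipIsing

end

/-!
For couplings `v` of the last vertex with the others, the interaction screening objective
`𝔼 exp (-z_n ∑ v_j z_j)` is convex and is minimized at the true couplings. Reversing the spin of
the last vertex replaces `exp (-X) - 1` by `cosh X - 1 ≥ X ^ 2 / 2` in the objective gap, and
reversing any other spin `i` bounds the resulting second moment below by a multiple of
`(v_i - A_{ni}) ^ 2`: the gap controls the error of every coordinate.

The gradient of the objective is an expectation of products of functions of single spins, so
inverting the transition matrix of every flip gives an unbiased estimator from flipped samples,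
namely the one of the algorithm. Its size depends only on the `ℓ¹` norm of `v`. The algorithm
is multiplicative weights run on these estimates: its regret is bounded deterministically, and
replacing estimated by true gradients costs a sum of bounded martingale differences, which Azuma's
inequality controls. By convexity the average of the gaps along the iterates is small, hence so is
the error of the averaged iterate.
-/

namespace FlipIsing

open Finset Real

noncomputable section

/-! ### Multiplicative weights -/

lemma sub_two_mul_sq_le_log_one_add {y : ℝ} (hy : -(1 / 2) ≤ y) :
    y - 2 * y ^ 2 ≤ log (1 + y) := by
  have hpos : 0 < 1 + y := by linarith
  refine le_trans ?_ (one_sub_inv_le_log_of_pos hpos)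
  rw [← sub_nonneg]
  have h : 1 - (1 + y)⁻¹ - (y - 2 * y ^ 2) = y ^ 2 * (1 + 2 * y) / (1 + y) := by
    field_simp
    ring
  rw [h]
  have : 0 ≤ 1 + 2 * y := by linarith
  positivity

section MultiplicativeWeights

variable {ι : Type*} [Fintype ι]

/-- The relative interior of the simplex of nonnegative vectors with total mass `r`, in which the
iterates of the multiplicative weights method live. -/
def openSimplex (ι : Type*) [Fintype ι] (r : ℝ) : Set (ι → ℝ) :=
  {w | (∀ a, 0 < w a) ∧ ∑ a, w a = r}

/-- The relative change of the coordinates of `w` in one multiplicative weights update with loss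
vector `g` and step size `η`; centring the loss keeps the total mass equal to `r`. -/
def relChange (r η : ℝ) (w g : ι → ℝ) (a : ι) : ℝ :=
  η * ((∑ b, w b * g b) / r - g a)

/-- One linearized multiplicative weights update. -/
def mwStep (r η : ℝ) (w g : ι → ℝ) (a : ι) : ℝ :=
  w a * (1 + relChange r η w g a)

variable {r η B : ℝ} {w g u : ι → ℝ}

lemma le_of_mem_openSimplex (hw : w ∈ openSimplex ι r) (a : ι) : w a ≤ r :=
  hw.2 ▸ single_le_sum (fun b _ => (hw.1 b).le) (mem_univ a)

lemma const_mem_openSimplex [Nonempty ι] (hr : 0 < r) :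
    (fun _ : ι => r / Fintype.card ι) ∈ openSimplex ι r := by
  have hcard : (0 : ℝ) < Fintype.card ι := Nat.cast_pos.mpr Fintype.card_pos
  refine ⟨fun _ => div_pos hr hcard, ?_⟩
  rw [sum_const, card_univ, nsmul_eq_mul, mul_div_cancel₀ _ hcard.ne']

lemma abs_relChange_le (hr : 0 < r) (hη : 0 ≤ η) (hw : w ∈ openSimplex ι r)
    (hg : ∀ a, |g a| ≤ B) (a : ι) : |relChange r η w g a| ≤ 2 * (η * B) := by
  have hmean : |(∑ b, w b * g b) / r| ≤ B := by
    rw [abs_div, abs_of_pos hr, div_le_iff₀' hr]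
    calc |∑ b, w b * g b| ≤ ∑ b, |w b * g b| := abs_sum_le_sum_abs _ _
      _ ≤ ∑ b, w b * B := sum_le_sum fun b _ => by
          rw [abs_mul, abs_of_pos (hw.1 b)]
          exact mul_le_mul_of_nonneg_left (hg b) (hw.1 b).le
      _ = r * B := by rw [← sum_mul, hw.2]
  rw [relChange, abs_mul, abs_of_nonneg hη, mul_left_comm]
  refine mul_le_mul_of_nonneg_left ((abs_sub _ _).trans ?_) hη
  linarith [hg a]

lemma sum_mul_relChange (hu : ∑ a, u a = r) (hr : r ≠ 0) :
    ∑ a, u a * relChange r η w g a = η * ∑ a, (w a - u a) * g a := by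
  simp only [relChange, mul_sub, sub_mul, mul_left_comm _ η, sum_sub_distrib, ← mul_sum, ← sum_mul,
    hu]
  field_simp

lemma mwStep_mem_openSimplex (hr : 0 < r) (hη : 0 ≤ η) (hηB : 4 * (η * B) ≤ 1)
    (hw : w ∈ openSimplex ι r) (hg : ∀ a, |g a| ≤ B) : mwStep r η w g ∈ openSimplex ι r := by
  constructor
  · intro a
    have h := neg_le_of_abs_le (abs_relChange_le hr hη hw hg a)
    exact mul_pos (hw.1 a) (by linarith)
  · simp only [mwStep, mul_one_add, sum_add_distrib, sum_mul_relChange hw.2 hr.ne', hw.2, sub_self,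
      zero_mul, sum_const_zero, mul_zero, add_zero]

/-- Up to terms depending only on `u`, the potential `∑ u log w` is minus the relative entropy of
`u` with respect to `w`. -/
lemma mul_sum_sub_mul_le_potential_sub (hr : 0 < r) (hη : 0 ≤ η) (hηB : 4 * (η * B) ≤ 1)
    (hw : w ∈ openSimplex ι r) (hg : ∀ a, |g a| ≤ B) (hu : ∀ a, 0 ≤ u a) (hus : ∑ a, u a = r) :
    η * ∑ a, (w a - u a) * g a ≤
      (∑ a, u a * log (mwStep r η w g a)) - (∑ a, u a * log (w a)) + 8 * r * η ^ 2 * B ^ 2 := by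
  have hlog : ∀ a, relChange r η w g a - 8 * η ^ 2 * B ^ 2 ≤
      log (mwStep r η w g a) - log (w a) := fun a => by
    have habs := abs_relChange_le hr hη hw hg a
    have hlow := neg_le_of_abs_le habs
    have hsq : relChange r η w g a ^ 2 ≤ (2 * (η * B)) ^ 2 := sq_le_sq' hlow (le_of_abs_le habs)
    have hlog := sub_two_mul_sq_le_log_one_add (y := relChange r η w g a) (by linarith)
    have hpos : 0 < 1 + relChange r η w g a := by linarith
    rw [mwStep, log_mul (hw.1 a).ne' hpos.ne']
    linarith
  have hsum := sum_le_sum fun a (_ : a ∈ univ) => mul_le_mul_of_nonneg_left (hlog a) (hu a)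
  simp only [mul_sub, sum_sub_distrib, ← sum_mul, hus, sum_mul_relChange hus hr.ne'] at hsum
  linarith

theorem regret_le [Nonempty ι] {T : ℕ} (hr : 0 < r) (hη : 0 ≤ η) (hηB : 4 * (η * B) ≤ 1)
    {w g : ℕ → ι → ℝ} (hw0 : w 0 = fun _ => r / Fintype.card ι)
    (hstep : ∀ t < T, w (t + 1) = mwStep r η (w t) (g t))
    (hw : ∀ t, w t ∈ openSimplex ι r) (hg : ∀ t < T, ∀ a, |g t a| ≤ B)
    (hu : ∀ a, 0 ≤ u a) (hus : ∑ a, u a = r) :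
    η * ∑ t ∈ range T, ∑ a, (w t a - u a) * g t a ≤
      r * log (Fintype.card ι) + T * (8 * r * η ^ 2 * B ^ 2) := by
  set Φ : ℕ → ℝ := fun t => ∑ a, u a * log (w t a) with hΦ
  have hinc : ∀ t ∈ range T, η * ∑ a, (w t a - u a) * g t a ≤
      Φ (t + 1) - Φ t + 8 * r * η ^ 2 * B ^ 2 := fun t ht => by
    have ht := mem_range.mp ht
    simp only [hΦ, hstep t ht]
    exact mul_sum_sub_mul_le_potential_sub hr hη hηB (hw t) (hg t ht) hu hus
  have hcard : (Fintype.card ι : ℝ) ≠ 0 := Nat.cast_ne_zero.mpr Fintype.card_ne_zero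
  have hfirst : Φ 0 = r * log r - r * log (Fintype.card ι) := by
    simp only [hΦ, hw0, ← sum_mul, hus, log_div hr.ne' hcard]
    ring
  have hlast : Φ T ≤ r * log r := by
    rw [← hus, sum_mul]
    refine sum_le_sum fun a _ => mul_le_mul_of_nonneg_left ?_ (hu a)
    rw [hus]
    exact log_le_log ((hw T).1 a) (le_of_mem_openSimplex (hw T) a)
  have hsum := sum_le_sum hinc
  rw [sum_add_distrib, sum_range_sub, sum_const, card_range, nsmul_eq_mul, ← mul_sum] at hsum
  linarith

end MultiplicativeWeights

/-! ### The simplex and the `ℓ¹` ball -/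

section Simplex

variable {k T : ℕ} {p : Fin (k + 1) → ℝ} {lam η B : ℝ} {w : Coord k → ℝ}

lemma sum_coord (f : Coord k → ℝ) :
    ∑ a, f a =
      (∑ i, f (Sum.inl i)) + ((∑ i, f (Sum.inr (Sum.inl i))) + f (Sum.inr (Sum.inr ()))) := by
  simp only [Fintype.sum_sum_type, univ_unique, PUnit.default_eq_unit, sum_singleton]

lemma card_coord (k : ℕ) : Fintype.card (Coord k) = 2 * k + 1 := by
  simp only [Fintype.card_sum, Fintype.card_fin, Fintype.card_unit]
  ring

lemma sum_abs_toBall_le (hw : w ∈ openSimplex (Coord k) lam) : ∑ i, |toBall w i| ≤ lam := by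
  have habs : ∀ i, |toBall w i| ≤ w (Sum.inl i) + w (Sum.inr (Sum.inl i)) := fun i =>
    (abs_sub _ _).trans_eq (by rw [abs_of_pos (hw.1 _), abs_of_pos (hw.1 _)])
  calc ∑ i, |toBall w i| ≤ ∑ i, (w (Sum.inl i) + w (Sum.inr (Sum.inl i))) :=
        sum_le_sum fun i _ => habs i
    _ ≤ ∑ a, w a := by
        rw [sum_coord, sum_add_distrib]
        linarith [hw.1 (Sum.inr (Sum.inr ()))]
    _ = lam := hw.2

/-- A preimage under `toBall` of a point `v` of the `ℓ¹` ball of radius `lam`: the positive and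
negative parts of `v`, with the remaining mass on the last coordinate. -/
def liftBall (lam : ℝ) (v : Fin k → ℝ) : Coord k → ℝ
  | Sum.inl i => (v i)⁺
  | Sum.inr (Sum.inl i) => (v i)⁻
  | Sum.inr (Sum.inr _) => lam - ∑ i, |v i|

lemma toBall_liftBall (lam : ℝ) (v : Fin k → ℝ) (i : Fin k) : toBall (liftBall lam v) i = v i :=
  posPart_sub_negPart (v i)

lemma liftBall_nonneg {v : Fin k → ℝ} (hv : ∑ i, |v i| ≤ lam) : ∀ a, 0 ≤ liftBall lam v a
  | Sum.inl i => posPart_nonneg (v i)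
  | Sum.inr (Sum.inl i) => negPart_nonneg (v i)
  | Sum.inr (Sum.inr _) => sub_nonneg.mpr hv

lemma sum_liftBall (lam : ℝ) (v : Fin k → ℝ) : ∑ a, liftBall lam v a = lam := by
  rw [sum_coord, ← add_assoc, ← sum_add_distrib]
  simp only [liftBall, posPart_add_negPart, add_sub_cancel]

lemma sum_mul_GFlip (p : Fin (k + 1) → ℝ) (u w : Coord k → ℝ) (x : Config (k + 1)) :
    ∑ a, u a * GFlip p w x a = ∑ i, toBall u i * gFlip p i w x := by
  rw [sum_coord]
  simp only [GFlip, toBall, mul_zero, add_zero, sub_mul, mul_neg, sum_sub_distrib, sum_neg_distrib]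
  ring

lemma abs_GFlip_le {x : Config (k + 1)} (hB : 0 ≤ B) (h : ∀ i, |gFlip p i w x| ≤ B) :
    ∀ a, |GFlip p w x a| ≤ B
  | Sum.inl i => h i
  | Sum.inr (Sum.inl i) => by simpa only [GFlip, abs_neg] using h i
  | Sum.inr (Sum.inr _) => by simpa only [GFlip, abs_zero] using hB

lemma smgStep_eq_mwStep (p : Fin (k + 1) → ℝ) (lam η : ℝ) (w : Coord k → ℝ)
    (x : Config (k + 1)) : smgStep p lam η w x = mwStep lam η w (GFlip p w x) := by
  funext a
  rw [smgStep, mwStep, relChange]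
  ring

lemma smgIter_zero (p : Fin (k + 1) → ℝ) (lam η : ℝ) (x : Fin T → Config (k + 1)) :
    smgIter p lam η x 0 = fun _ => lam / Fintype.card (Coord k) := by
  rw [smgIter, card_coord]
  push_cast
  rfl

lemma smgIter_succ (p : Fin (k + 1) → ℝ) (lam η : ℝ) (x : Fin T → Config (k + 1)) (t : Fin T) :
    smgIter p lam η x (t + 1) = smgStep p lam η (smgIter p lam η x t) (x t) := by
  rw [smgIter, dif_pos t.2]

lemma smgIter_mem_openSimplex (hlam : 0 < lam) (hη : 0 ≤ η) (hB : 0 ≤ B) (hηB : 4 * (η * B) ≤ 1)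
    (hg : ∀ w ∈ openSimplex (Coord k) lam, ∀ x i, |gFlip p i w x| ≤ B)
    (x : Fin T → Config (k + 1)) (t : ℕ) :
    smgIter p lam η x t ∈ openSimplex (Coord k) lam := by
  induction t with
  | zero => exact smgIter_zero p lam η x ▸ const_mem_openSimplex hlam
  | succ t ih =>
    rw [smgIter]
    split_ifs with ht
    · rw [smgStep_eq_mwStep]
      exact mwStep_mem_openSimplex hlam hη hηB ih (abs_GFlip_le hB (hg _ ih _))
    · exact ih

theorem smg_regret_le (hlam : 0 < lam) (hη : 0 ≤ η) (hB : 0 ≤ B) (hηB : 4 * (η * B) ≤ 1)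
    (hg : ∀ w ∈ openSimplex (Coord k) lam, ∀ x i, |gFlip p i w x| ≤ B)
    (x : Fin T → Config (k + 1)) {v : Fin k → ℝ} (hv : ∑ i, |v i| ≤ lam) :
    η * ∑ t : Fin T, ∑ i, (toBall (smgIter p lam η x t) i - v i) *
        gFlip p i (smgIter p lam η x t) (x t) ≤
      lam * log (2 * k + 1) + T * (8 * lam * η ^ 2 * B ^ 2) := by
  have hw := smgIter_mem_openSimplex hlam hη hB hηB hg x
  set g : ℕ → Coord k → ℝ := fun t =>
    if ht : t < T then GFlip p (smgIter p lam η x t) (x ⟨t, ht⟩) else 0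
  have hgt : ∀ t : Fin T, g t = GFlip p (smgIter p lam η x t) (x t) := fun t => dif_pos t.2
  have hregret := regret_le (T := T) (g := g) hlam hη hηB (smgIter_zero p lam η x)
    (fun t ht => by rw [smgIter_succ p lam η x ⟨t, ht⟩, smgStep_eq_mwStep, hgt ⟨t, ht⟩]) hw
    (fun t ht a => hgt ⟨t, ht⟩ ▸ abs_GFlip_le hB (hg _ (hw t) _) a)
    (liftBall_nonneg hv) (sum_liftBall lam v)
  rw [sum_range, card_coord] at hregret
  push_cast at hregret
  refine le_trans (le_of_eq ?_) hregret
  congr 1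
  refine sum_congr rfl fun t _ => ?_
  simp only [hgt, sub_mul, sum_sub_distrib, sum_mul_GFlip, toBall_liftBall]

end Simplex

/-! ### Azuma's inequality for functions of independent variables -/

section Azuma

open scoped NNReal

lemma hasSubgaussianMGF_of_abs_le {Ω : Type*} [MeasurableSpace Ω] {μ : Measure Ω}
    [IsProbabilityMeasure μ] {X : Ω → ℝ} {c : ℝ≥0} (hX : Measurable X) (hc : ∀ ω, |X ω| ≤ c)
    (hmean : ∫ ω, X ω ∂μ = 0) : HasSubgaussianMGF X (c ^ 2) μ := by
  have h := hasSubgaussianMGF_of_mem_Icc_of_integral_eq_zero hX.aemeasurable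
    (ae_of_all μ fun ω => abs_le.mp (hc ω)) hmean
  have hcc : ‖(c : ℝ) - -c‖₊ / 2 = c := by
    rw [sub_neg_eq_add, ← two_mul, nnnorm_mul, nnnorm_ofNat, NNReal.nnnorm_eq,
      mul_div_cancel_left₀ _ two_ne_zero]
  rwa [hcc] at h

variable {ι : Type*} [Fintype ι] {α : ι → Type*} [∀ i, MeasurableSpace (α i)]
  {μ : ∀ i, Measure (α i)} [∀ i, IsProbabilityMeasure (μ i)]

lemma measurePreserving_update_pi [DecidableEq ι] (i : ι) :
    MeasurePreserving (fun q : (∀ j, α j) × α i => Function.update q.1 i q.2)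
      ((Measure.pi μ).prod (μ i)) (Measure.pi μ) := by
  refine ⟨measurable_update', (Measure.pi_eq fun s hs => ?_).symm⟩
  have hpre : (fun q : (∀ j, α j) × α i => Function.update q.1 i q.2) ⁻¹' Set.univ.pi s =
      Set.univ.pi (Function.update s i Set.univ) ×ˢ s i := by
    ext q
    rw [Set.mem_preimage, Set.update_mem_pi_iff, Set.mem_prod, ← Set.compl_eq_univ_sdiff,
      Set.univ_pi_update i s Set.univ fun _ t => t]
    simp only [Set.mem_univ, true_imp_iff, Set.ofPred_true, Set.univ_inter]
  have hprod : ∏ j, μ j (Function.update s i Set.univ j) = ∏ j ∈ univ \ {i}, μ j (s j) := by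
    simp only [Function.apply_update fun j => μ j]
    rw [prod_update_of_mem (mem_univ i), measure_univ, one_mul]
  rw [Measure.map_apply measurable_update' (MeasurableSet.univ_pi hs), hpre, Measure.prod_prod,
    Measure.pi_pi, hprod, mul_comm,
    prod_eq_mul_prod_sdiff_singleton_of_mem (mem_univ i) fun j => μ j (s j)]

lemma integral_pi_eq_integral_integral_update [DecidableEq ι] (i : ι) {f : (∀ j, α j) → ℝ}
    (hf : Integrable f (Measure.pi μ)) :
    ∫ x, f x ∂Measure.pi μ = ∫ x, ∫ y, f (Function.update x i y) ∂μ i ∂Measure.pi μ := by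
  have hmp := measurePreserving_update_pi (μ := μ) i
  calc ∫ x, f x ∂Measure.pi μ
      = ∫ q, f (Function.update q.1 i q.2) ∂(Measure.pi μ).prod (μ i) := by
        rw [← integral_map hmp.measurable.aemeasurable (hmp.map_eq.symm ▸ hf.aestronglyMeasurable),
          hmp.map_eq]
    _ = ∫ x, ∫ y, f (Function.update x i y) ∂μ i ∂Measure.pi μ :=
        integral_prod _ (hmp.integrable_comp_of_integrable hf)

/-- Resampling the coordinate `i` leaves `S` unchanged and averages `exp (t X)`. -/
lemma hasSubgaussianMGF_add_of_update [DecidableEq ι] {S X : (∀ j, α j) → ℝ} {c d : ℝ≥0} (i : ι)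
    (hS : HasSubgaussianMGF S c (Measure.pi μ))
    (hSi : ∀ x y, S (Function.update x i y) = S x)
    (hX : Measurable X) (hd : ∀ x, |X x| ≤ d)
    (hmean : ∀ x, ∫ y, X (Function.update x i y) ∂μ i = 0) :
    HasSubgaussianMGF (fun x => X x + S x) (d ^ 2 + c) (Measure.pi μ) := by
  have hint : ∀ t, Integrable (fun x => exp (t * (X x + S x))) (Measure.pi μ) := fun t => by
    simp only [mul_add, exp_add]
    refine (hS.integrable_exp_mul t).bdd_mul (c := exp (|t| * d))
      (hX.const_mul t).exp.aestronglyMeasurable (ae_of_all _ fun x => ?_)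
    rw [norm_of_nonneg (exp_pos _).le]
    refine exp_le_exp.mpr ((le_abs_self _).trans ?_)
    rw [abs_mul]
    exact mul_le_mul_of_nonneg_left (hd x) (abs_nonneg t)
  refine ⟨hint, fun t => ?_⟩
  have hinner : ∀ x, ∫ y, exp (t * (X (Function.update x i y) + S (Function.update x i y))) ∂μ i ≤
      exp (d ^ 2 * t ^ 2 / 2) * exp (t * S x) := fun x => by
    have hmgf := (hasSubgaussianMGF_of_abs_le (μ := μ i) (hX.comp (measurable_update x))
      (fun y => hd _) (hmean x)).mgf_le t
    simp only [hSi, mul_add, exp_add, integral_mul_const]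
    exact mul_le_mul_of_nonneg_right (by exact_mod_cast hmgf) (exp_pos _).le
  calc mgf (fun x => X x + S x) (Measure.pi μ) t
      ≤ ∫ x, exp (d ^ 2 * t ^ 2 / 2) * exp (t * S x) ∂Measure.pi μ := by
        rw [mgf, integral_pi_eq_integral_integral_update i (hint t)]
        exact integral_mono_of_nonneg (ae_of_all _ fun x => integral_nonneg fun y => (exp_pos _).le)
          ((hS.integrable_exp_mul t).const_mul _) (ae_of_all _ hinner)
    _ ≤ exp (d ^ 2 * t ^ 2 / 2) * exp (c * t ^ 2 / 2) := by
        rw [integral_const_mul]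
        exact mul_le_mul_of_nonneg_left (hS.mgf_le t) (exp_pos _).le
    _ = exp (((d ^ 2 + c : ℝ≥0) : ℝ) * t ^ 2 / 2) := by
        rw [← exp_add]
        push_cast
        ring_nf

theorem hasSubgaussianMGF_sum_of_predictable [LinearOrder ι] {M : ι → (∀ j, α j) → ℝ}
    {c : ι → ℝ≥0} (hM : ∀ i, Measurable (M i)) (hc : ∀ i x, |M i x| ≤ c i)
    (hpred : ∀ i j, i < j → ∀ x y, M i (Function.update x j y) = M i x)
    (hmean : ∀ i x, ∫ y, M i (Function.update x i y) ∂μ i = 0) (s : Finset ι) :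
    HasSubgaussianMGF (fun x => ∑ i ∈ s, M i x) (∑ i ∈ s, c i ^ 2) (Measure.pi μ) := by
  induction s using Finset.induction_on_max with
  | empty => simpa only [sum_empty] using HasSubgaussianMGF.fun_zero
  | insert i s hlt ih =>
    have hi : i ∉ s := fun h => (hlt i h).false
    simp only [sum_insert hi]
    exact hasSubgaussianMGF_add_of_update i ih
      (fun x y => sum_congr rfl fun j hj => hpred j i (hlt j hj) x y) (hM i) (hc i) (hmean i)

theorem measureReal_sum_ge_le_of_predictable [LinearOrder ι] {M : ι → (∀ j, α j) → ℝ} {c : ℝ≥0}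
    (hM : ∀ i, Measurable (M i)) (hc : ∀ i x, |M i x| ≤ c)
    (hpred : ∀ i j, i < j → ∀ x y, M i (Function.update x j y) = M i x)
    (hmean : ∀ i x, ∫ y, M i (Function.update x i y) ∂μ i = 0)
    {Ω : Type*} [MeasurableSpace Ω] {P : Measure Ω} [IsProbabilityMeasure P] {X : ∀ i, Ω → α i}
    (hX : ∀ i, HasLaw (X i) (μ i) P) (hind : iIndepFun X P) {ε : ℝ} (hε : 0 ≤ ε) :
    P.real {ω | ε ≤ ∑ i, M i fun j => X j ω} ≤
      exp (-ε ^ 2 / (2 * (Fintype.card ι * c ^ 2))) := by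
  have hmeas : ∀ i, AEMeasurable (X i) P := fun i => (hX i).aemeasurable
  have hlaw : P.map (fun ω j => X j ω) = Measure.pi μ := by
    rw [(iIndepFun_iff_map_fun_eq_pi_map hmeas).mp hind]
    simp only [(hX _).map_eq]
  have hsub := hasSubgaussianMGF_sum_of_predictable hM hc hpred hmean univ
  rw [← hlaw] at hsub
  have htail := (HasSubgaussianMGF.of_map (aemeasurable_pi_lambda _ hmeas) hsub).measure_ge_le hε
  simpa only [Function.comp_apply, sum_const, card_univ, nsmul_eq_mul, NNReal.coe_mul,
    NNReal.coe_natCast, NNReal.coe_pow] using htail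

end Azuma

/-! ### Spins and independent flips -/

section Spins

variable {n : ℕ}

instance : MeasurableSingletonClass ℤˣ where
  measurableSet_singleton s := ⟨{(s : ℤ)}, MeasurableSet.of_discrete, by
    ext t
    simp only [Set.mem_preimage, Set.mem_singleton_iff, Units.ext_iff]⟩

@[simp] lemma spin_one : spin 1 = 1 := by simp [spin]

@[simp] lemma spin_neg (s : ℤˣ) : spin (-s) = -spin s := by simp [spin]

lemma abs_spin (s : ℤˣ) : |spin s| = 1 := by
  rcases Int.units_eq_one_or s with rfl | rfl <;> simp

lemma isProbabilityMeasure_rad {q : ℝ} (h0 : 0 ≤ q) (h1 : q ≤ 1) :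
    IsProbabilityMeasure (rad q) :=
  ⟨by simp [rad, ← ENNReal.ofReal_add h0 (sub_nonneg.mpr h1)]⟩

lemma integral_rad {q : ℝ} (h0 : 0 ≤ q) (h1 : q ≤ 1) (f : ℤˣ → ℝ) :
    ∫ s, f s ∂rad q = q * f 1 + (1 - q) * f (-1) := by
  rw [rad, integral_add_measure (Integrable.smul_measure .of_finite ENNReal.ofReal_ne_top)
    (Integrable.smul_measure .of_finite ENNReal.ofReal_ne_top)]
  simp only [integral_smul_measure, integral_dirac, ENNReal.toReal_ofReal h0,
    ENNReal.toReal_ofReal (sub_nonneg.mpr h1), smul_eq_mul]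

lemma partitionFn_pos (A : Matrix (Fin n) (Fin n) ℝ) (θ : Fin n → ℝ) : 0 < partitionFn A θ :=
  sum_pos (fun _ _ => exp_pos _) univ_nonempty

lemma isingWeight_div_partitionFn_nonneg (A : Matrix (Fin n) (Fin n) ℝ) (θ : Fin n → ℝ)
    (z : Config n) : 0 ≤ isingWeight A θ z / partitionFn A θ :=
  div_nonneg (exp_pos _).le (partitionFn_pos A θ).le

instance isProbabilityMeasure_ising (A : Matrix (Fin n) (Fin n) ℝ) (θ : Fin n → ℝ) :
    IsProbabilityMeasure (ising A θ) where
  measure_univ := by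
    simp only [ising, Measure.coe_finsetSum, Finset.sum_apply, Measure.smul_apply, measure_univ,
      smul_eq_mul, mul_one]
    rw [← ENNReal.ofReal_sum_of_nonneg fun z _ => isingWeight_div_partitionFn_nonneg A θ z,
      ← sum_div, ← partitionFn, div_self (partitionFn_pos A θ).ne', ENNReal.ofReal_one]

lemma isProbabilityMeasure_flip {p : Fin n → ℝ} (hp0 : ∀ i, 0 ≤ p i)
    (hp : ∀ i, p i < 1 / 2) (i : Fin n) : IsProbabilityMeasure (rad (1 - p i)) :=
  isProbabilityMeasure_rad (by linarith [hp i]) (sub_le_self 1 (hp0 i))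

lemma isProbabilityMeasure_flipped (A : Matrix (Fin n) (Fin n) ℝ) (θ : Fin n → ℝ)
    {p : Fin n → ℝ} (hp0 : ∀ i, 0 ≤ p i) (hp : ∀ i, p i < 1 / 2) :
    IsProbabilityMeasure (flipped A θ p) := by
  have := isProbabilityMeasure_flip hp0 hp
  exact Measure.isProbabilityMeasure_map Measurable.of_discrete.aemeasurable

lemma integral_ising (A : Matrix (Fin n) (Fin n) ℝ) (θ : Fin n → ℝ) (f : Config n → ℝ) :
    ∫ z, f z ∂ising A θ = (∑ z, isingWeight A θ z * f z) / partitionFn A θ := by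
  rw [ising, integral_finsetSum_measure fun z _ =>
    Integrable.smul_measure .of_finite ENNReal.ofReal_ne_top, sum_div]
  refine sum_congr rfl fun z _ => ?_
  rw [integral_smul_measure, integral_dirac,
    ENNReal.toReal_ofReal (isingWeight_div_partitionFn_nonneg A θ z), smul_eq_mul,
    mul_div_right_comm]

end Spins

/-! ### The interaction screening objective -/

section Involution

variable {α : Type*} [Fintype α] {σ : α → α} {R X : α → ℝ}

lemma two_mul_sum_eq_sum_add_involutive (hσ : Function.Involutive σ) (f : α → ℝ) :
    2 * ∑ a, f a = ∑ a, (f a + f (σ a)) := by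
  rw [two_mul, sum_add_distrib, hσ.bijective.sum_comp]

lemma one_add_sq_div_two_le_cosh (x : ℝ) : 1 + x ^ 2 / 2 ≤ cosh x := by
  have hsinh : (x / 2) ^ 2 ≤ sinh (x / 2) ^ 2 := by
    rw [sq_le_sq, abs_sinh]
    exact self_le_sinh_iff.mpr (abs_nonneg _)
  have hcosh := cosh_two_mul (x / 2)
  rw [mul_div_cancel₀ x two_ne_zero, cosh_sq] at hcosh
  linarith

lemma sum_mul_sq_le_of_odd_involutive (hσ : Function.Involutive σ) (hR : ∀ a, 0 ≤ R a)
    (hRσ : ∀ a, R (σ a) = R a) (hXσ : ∀ a, X (σ a) = -X a) :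
    ∑ a, R a * X a ^ 2 ≤ 2 * ∑ a, R a * (exp (-X a) - 1) := by
  rw [two_mul_sum_eq_sum_add_involutive hσ]
  refine sum_le_sum fun a _ => ?_
  have hcosh := one_add_sq_div_two_le_cosh (X a)
  rw [cosh_eq] at hcosh
  rw [hRσ, hXσ, neg_neg, ← mul_add]
  exact mul_le_mul_of_nonneg_left (by linarith) (hR a)

/-- At least one of `X a`, `X (σ a)` has absolute value at least `|d|`. -/
lemma mul_sum_mul_sq_le_of_involutive (hσ : Function.Involutive σ) (hR : ∀ a, 0 ≤ R a) {ρ d : ℝ}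
    (hρ : 0 ≤ ρ) (hρ1 : ρ ≤ 1) (hRσ : ∀ a, ρ * R a ≤ R (σ a))
    (hX : ∀ a, (X a - X (σ a)) ^ 2 = 4 * d ^ 2) :
    ρ * (∑ a, R a) * d ^ 2 ≤ ∑ a, R a * X a ^ 2 := by
  refine le_of_mul_le_mul_left ?_ (two_pos (α := ℝ))
  rw [two_mul_sum_eq_sum_add_involutive hσ, mul_sum, sum_mul, mul_sum]
  refine sum_le_sum fun a _ => ?_
  have hmean : 2 * d ^ 2 ≤ X a ^ 2 + X (σ a) ^ 2 := by
    linarith [hX a, add_sq_le (a := X a) (b := -X (σ a))]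
  calc 2 * (ρ * R a * d ^ 2) = ρ * R a * (2 * d ^ 2) := by ring
    _ ≤ ρ * R a * (X a ^ 2 + X (σ a) ^ 2) :=
        mul_le_mul_of_nonneg_left hmean (mul_nonneg hρ (hR a))
    _ = ρ * R a * X a ^ 2 + ρ * R a * X (σ a) ^ 2 := mul_add _ _ _
    _ ≤ R a * X a ^ 2 + R (σ a) * X (σ a) ^ 2 :=
        add_le_add (mul_le_mul_of_nonneg_right (mul_le_of_le_one_left (hR a) hρ1) (sq_nonneg _))
          (mul_le_mul_of_nonneg_right (hRσ a) (sq_nonneg _))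

end Involution

section Reverse

variable {n : ℕ} {A : Matrix (Fin n) (Fin n) ℝ}

/-- The configuration `z` with the spin at `m` reversed. -/
def reverse (m : Fin n) (z : Config n) : Config n := Function.update z m (-z m)

lemma reverse_self (m : Fin n) (z : Config n) : reverse m z m = -z m :=
  Function.update_self ..

lemma reverse_of_ne {m j : Fin n} (h : j ≠ m) (z : Config n) : reverse m z j = z j :=
  Function.update_of_ne h ..

lemma reverse_involutive (m : Fin n) : Function.Involutive (reverse m) := fun z => by
  simp [reverse]

lemma spin_reverse (m : Fin n) (z : Config n) :
    (fun j => spin (reverse m z j)) = (fun j => spin (z j)) - Pi.single m (2 * spin (z m)) := by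
  funext j
  rcases eq_or_ne j m with rfl | hj
  · rw [reverse_self, spin_neg, Pi.sub_apply, Pi.single_eq_same]
    ring
  · rw [reverse_of_ne hj, Pi.sub_apply, Pi.single_eq_of_ne hj, sub_zero]

/-- The exponent `∑_{i < j} A_ij z_i z_j` of the Ising weight without external field. -/
def energy (A : Matrix (Fin n) (Fin n) ℝ) (z : Config n) : ℝ :=
  ∑ i, ∑ j ∈ Ioi i, A i j * spin (z i) * spin (z j)

lemma isingWeight_zero (A : Matrix (Fin n) (Fin n) ℝ) (z : Config n) :
    isingWeight A 0 z = exp (energy A z) := by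
  simp [isingWeight, energy]

open Matrix in
lemma two_mul_energy (hA : A.IsSymm) (hd : ∀ i, A i i = 0) (z : Config n) :
    2 * energy A z = (fun i => spin (z i)) ⬝ᵥ A *ᵥ (fun i => spin (z i)) := by
  set f : Fin n → Fin n → ℝ := fun i j => A i j * spin (z i) * spin (z j) with hf
  have hsymm : ∀ i j, f j i = f i j := fun i j => by
    simp only [hf, hA.apply i j]
    ring
  have hdiag : ∀ i, f i i = 0 := fun i => by simp only [hf, hd, zero_mul]
  have hoff : ∀ i, ∑ j ∈ {i}ᶜ, f j i = ∑ j, f i j := fun i => by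
    simp only [hsymm, ← sum_add_sum_compl {i} (f i), sum_singleton, hdiag, zero_add]
  calc 2 * energy A z = ∑ i, ∑ j ∈ Ioi i, (f j i + f i j) := by
        simp only [hsymm, ← two_mul, ← mul_sum]
        rfl
    _ = ∑ i, ∑ j, f i j := by simp only [sum_sum_Ioi_add_eq_sum_sum_off_diag, hoff]
    _ = _ := by
        simp only [dotProduct, mulVec, mul_sum, hf]
        exact sum_congr rfl fun i _ => sum_congr rfl fun j _ => by ring

open Matrix in
lemma energy_reverse (hA : A.IsSymm) (hd : ∀ i, A i i = 0) (m : Fin n) (z : Config n) :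
    energy A (reverse m z) = energy A z - 2 * (spin (z m) * ∑ j, A m j * spin (z j)) := by
  have hrev := two_mul_energy hA hd (reverse m z)
  rw [spin_reverse, mulVec_sub, sub_dotProduct, dotProduct_sub, dotProduct_sub,
    dotProduct_mulVec (fun i => spin (z i)) A (Pi.single _ _), ← mulVec_transpose, hA.eq,
    single_dotProduct, dotProduct_single, single_dotProduct, mulVec_single,
    ← two_mul_energy hA hd] at hrev
  simp only [Pi.smul_apply, Matrix.col_apply, hd, smul_zero, mul_zero, mulVec, dotProduct] at hrev
  linarith

lemma abs_spin_mul_sum_le (s : ℤˣ) (a : Fin n → ℝ) (z : Config n) :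
    |spin s * ∑ j, a j * spin (z j)| ≤ ∑ j, |a j| := by
  rw [abs_mul, abs_spin, one_mul]
  refine (abs_sum_le_sum_abs _ _).trans_eq (sum_congr rfl fun j _ => ?_)
  rw [abs_mul, abs_spin, mul_one]

end Reverse

section Screening

variable {k : ℕ} {A : Matrix (Fin (k + 1)) (Fin (k + 1)) ℝ} {lam : ℝ}

/-- The part `z_n ∑ v_j z_j` of the energy in which the last vertex takes part when its couplings
are `v`. -/
def interaction (v : Fin k → ℝ) (z : Config (k + 1)) : ℝ :=
  spin (z (Fin.last k)) * ∑ j, v j * spin (z j.castSucc)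

lemma interaction_sub (u v : Fin k → ℝ) (z : Config (k + 1)) :
    interaction (u - v) z = interaction u z - interaction v z := by
  simp only [interaction, Pi.sub_apply, sub_mul, sum_sub_distrib, mul_sub]

lemma interaction_reverse_last (v : Fin k → ℝ) (z : Config (k + 1)) :
    interaction v (reverse (Fin.last k) z) = -interaction v z := by
  simp only [interaction, reverse_self, spin_neg, neg_mul,
    reverse_of_ne (Fin.castSucc_lt_last _).ne]

lemma interaction_reverse_castSucc (v : Fin k → ℝ) (i : Fin k) (z : Config (k + 1)) :
    interaction v (reverse i.castSucc z) =
      interaction v z - 2 * (spin (z (Fin.last k)) * (v i * spin (z i.castSucc))) := by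
  have hspin : ∀ j : Fin k, spin (reverse i.castSucc z j.castSucc) =
      spin (z j.castSucc) - if j = i then 2 * spin (z i.castSucc) else 0 := fun j => by
    rw [congrFun (spin_reverse i.castSucc z) j.castSucc, Pi.sub_apply, Pi.single_apply]
    simp only [Fin.castSucc_inj]
  simp only [interaction, reverse_of_ne (Fin.castSucc_lt_last i).ne', hspin, mul_sub,
    sum_sub_distrib, mul_ite, mul_zero, sum_ite_eq', mem_univ, if_true]
  ring

/-- The couplings of the last vertex. -/
def lastRow (A : Matrix (Fin (k + 1)) (Fin (k + 1)) ℝ) (i : Fin k) : ℝ :=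
  A (Fin.last k) i.castSucc

lemma interaction_lastRow (hd : ∀ i, A i i = 0) (z : Config (k + 1)) :
    interaction (lastRow A) z = spin (z (Fin.last k)) * ∑ j, A (Fin.last k) j * spin (z j) := by
  rw [Fin.sum_univ_castSucc, hd, zero_mul, add_zero]
  rfl

/-- The interaction screening objective at the last vertex, whose minimizer is `lastRow A`. -/
def screening (A : Matrix (Fin (k + 1)) (Fin (k + 1)) ℝ) (v : Fin k → ℝ) : ℝ :=
  ∫ z, exp (-interaction v z) ∂ising A 0

/-- The gradient of `screening A`. -/
def screeningGrad (A : Matrix (Fin (k + 1)) (Fin (k + 1)) ℝ) (v : Fin k → ℝ) (i : Fin k) : ℝ :=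
  ∫ z, -(spin (z (Fin.last k)) * spin (z i.castSucc) * exp (-interaction v z)) ∂ising A 0

theorem screening_sub_le (A : Matrix (Fin (k + 1)) (Fin (k + 1)) ℝ) (u v : Fin k → ℝ) :
    screening A v - screening A u ≤ ∑ i, (v i - u i) * screeningGrad A v i := by
  simp only [screening, screeningGrad, ← integral_const_mul]
  rw [← integral_sub .of_finite .of_finite, ← integral_finsetSum _ fun _ _ => .of_finite]
  refine integral_mono .of_finite .of_finite fun z => ?_
  have hsum : ∑ i, (v i - u i) *
      -(spin (z (Fin.last k)) * spin (z i.castSucc) * exp (-interaction v z)) =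
      -(interaction (v - u) z * exp (-interaction v z)) := by
    have hlin : interaction (v - u) z =
        ∑ i, (v i - u i) * (spin (z (Fin.last k)) * spin (z i.castSucc)) := by
      simp only [interaction, Pi.sub_apply, mul_sum, mul_left_comm]
    rw [hlin, sum_mul, ← sum_neg_distrib]
    exact sum_congr rfl fun i _ => by ring
  have hexp : exp (-interaction u z) =
      exp (-interaction v z) * exp (interaction (v - u) z) := by
    rw [← exp_add, interaction_sub]
    ring_nf
  have htangent := mul_le_mul_of_nonneg_left (add_one_le_exp (interaction (v - u) z))
    (exp_pos (-interaction v z)).le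
  simp only [hsum, hexp]
  linarith

/-- The Ising weight from which all couplings of the last vertex are removed. -/
def decoupledWeight (A : Matrix (Fin (k + 1)) (Fin (k + 1)) ℝ) (z : Config (k + 1)) : ℝ :=
  isingWeight A 0 z * exp (-interaction (lastRow A) z)

lemma decoupledWeight_eq_exp (A : Matrix (Fin (k + 1)) (Fin (k + 1)) ℝ) (z : Config (k + 1)) :
    decoupledWeight A z = exp (energy A z - interaction (lastRow A) z) := by
  rw [decoupledWeight, isingWeight_zero, sub_eq_add_neg, exp_add]

lemma decoupledWeight_nonneg (A : Matrix (Fin (k + 1)) (Fin (k + 1)) ℝ) (z : Config (k + 1)) :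
    0 ≤ decoupledWeight A z :=
  decoupledWeight_eq_exp A z ▸ (exp_pos _).le

lemma decoupledWeight_reverse_last (hA : A.IsSymm) (hd : ∀ i, A i i = 0) (z : Config (k + 1)) :
    decoupledWeight A (reverse (Fin.last k) z) = decoupledWeight A z := by
  rw [decoupledWeight_eq_exp, decoupledWeight_eq_exp, energy_reverse hA hd,
    interaction_reverse_last, interaction_lastRow hd]
  ring_nf

lemma exp_mul_decoupledWeight_le_reverse (hA : A.IsSymm) (hd : ∀ i, A i i = 0)
    (hlam : ∀ i, ∑ j, |A i j| ≤ lam) (i : Fin k) (z : Config (k + 1)) :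
    exp (-(4 * lam)) * decoupledWeight A z ≤ decoupledWeight A (reverse i.castSucc z) := by
  have hrow := (le_abs_self _).trans
    ((abs_spin_mul_sum_le (z i.castSucc) (A i.castSucc) z).trans (hlam _))
  have hentry : |spin (z (Fin.last k)) * (lastRow A i * spin (z i.castSucc))| ≤ lam := by
    rw [abs_mul, abs_mul, abs_spin, abs_spin, one_mul, mul_one]
    exact (single_le_sum (f := fun j => |A (Fin.last k) j|) (fun _ _ => abs_nonneg _)
      (mem_univ i.castSucc)).trans (hlam _)
  rw [decoupledWeight_eq_exp, decoupledWeight_eq_exp, ← exp_add, exp_le_exp,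
    energy_reverse hA hd, interaction_reverse_castSucc]
  linarith [neg_le_of_abs_le hentry]

lemma exp_mul_partitionFn_le_sum_decoupledWeight (hd : ∀ i, A i i = 0)
    (hlam : ∑ j, |A (Fin.last k) j| ≤ lam) :
    exp (-lam) * partitionFn A 0 ≤ ∑ z, decoupledWeight A z := by
  rw [partitionFn, mul_sum]
  refine sum_le_sum fun z _ => ?_
  rw [decoupledWeight, mul_comm, interaction_lastRow hd]
  refine mul_le_mul_of_nonneg_left (exp_le_exp.mpr (neg_le_neg ?_)) (exp_pos _).le
  exact (le_abs_self _).trans ((abs_spin_mul_sum_le _ _ z).trans hlam)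

lemma screening_sub_screening_lastRow (A : Matrix (Fin (k + 1)) (Fin (k + 1)) ℝ)
    (v : Fin k → ℝ) :
    screening A v - screening A (lastRow A) =
      (∑ z, decoupledWeight A z * (exp (-interaction (v - lastRow A) z) - 1)) /
        partitionFn A 0 := by
  rw [screening, screening, ← integral_sub .of_finite .of_finite, integral_ising]
  congr 1
  refine sum_congr rfl fun z _ => ?_
  have hexp : exp (-interaction v z) =
      exp (-interaction (lastRow A) z) * exp (-interaction (v - lastRow A) z) := by
    rw [← exp_add, interaction_sub]
    ring_nf
  rw [decoupledWeight, hexp]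
  ring

theorem exp_mul_sq_le_screening_sub (hA : A.IsSymm) (hd : ∀ i, A i i = 0)
    (hlam : ∀ i, ∑ j, |A i j| ≤ lam) (v : Fin k → ℝ) (i : Fin k) :
    exp (-(5 * lam)) * (v i - lastRow A i) ^ 2 ≤
      2 * (screening A v - screening A (lastRow A)) := by
  have hlam0 : 0 ≤ lam := (sum_nonneg fun j _ => abs_nonneg _).trans (hlam 0)
  have hsq : ∀ z, (interaction (v - lastRow A) z -
      interaction (v - lastRow A) (reverse i.castSucc z)) ^ 2 = 4 * (v i - lastRow A i) ^ 2 :=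
    fun z => by
      have hspin : ∀ s, spin s ^ 2 = 1 := fun s => by rw [← sq_abs, abs_spin, one_pow]
      rw [interaction_reverse_castSucc, sub_sub_cancel, mul_pow, mul_pow, mul_pow, hspin, hspin,
        Pi.sub_apply]
      ring
  rw [screening_sub_screening_lastRow, ← mul_div_assoc, le_div_iff₀ (partitionFn_pos A 0)]
  calc exp (-(5 * lam)) * (v i - lastRow A i) ^ 2 * partitionFn A 0
      = exp (-(4 * lam)) * (exp (-lam) * partitionFn A 0) * (v i - lastRow A i) ^ 2 := by
        rw [← mul_assoc, ← exp_add]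
        ring_nf
    _ ≤ exp (-(4 * lam)) * (∑ z, decoupledWeight A z) * (v i - lastRow A i) ^ 2 := by
        gcongr
        exact exp_mul_partitionFn_le_sum_decoupledWeight hd (hlam _)
    _ ≤ ∑ z, decoupledWeight A z * interaction (v - lastRow A) z ^ 2 :=
        mul_sum_mul_sq_le_of_involutive (reverse_involutive _) (decoupledWeight_nonneg A)
          (exp_pos _).le (exp_le_one_iff.mpr (by linarith))
          (exp_mul_decoupledWeight_le_reverse hA hd hlam i) hsq
    _ ≤ _ := sum_mul_sq_le_of_odd_involutive (reverse_involutive (Fin.last k))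
        (decoupledWeight_nonneg A) (decoupledWeight_reverse_last hA hd)
        (interaction_reverse_last _)

end Screening

/-! ### Debiased estimators -/

section Debias

variable {q c M : ℝ} {f : ℤˣ → ℝ}

/-- The estimator of `f s` from a flip of `s`, where `q` is the probability of a flip, obtained by
inverting the transition matrix of the flip. -/
def debias (q : ℝ) (f : ℤˣ → ℝ) (s : ℤˣ) : ℝ :=
  ((1 - q) * f s - q * f (-s)) / (1 - 2 * q)

lemma integral_debias (h0 : 0 ≤ q) (h1 : q ≤ 1) (hq : q ≠ 1 / 2) (f : ℤˣ → ℝ) (s : ℤˣ) :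
    ∫ c, debias q f (c * s) ∂rad (1 - q) = f s := by
  have hden : 1 - 2 * q ≠ 0 := fun h => hq (by linarith)
  rw [integral_rad (sub_nonneg.mpr h1) (sub_le_self 1 h0)]
  simp only [debias, one_mul, neg_mul, neg_neg]
  rw [mul_div_assoc', mul_div_assoc', ← add_div, div_eq_iff hden]
  ring

lemma abs_debias_le (h0 : 0 ≤ q) (hq : q < 1 / 2) (hc : (1 - 2 * q)⁻¹ ≤ c)
    (hf : ∀ s, |f s| ≤ M) (s : ℤˣ) : |debias q f s| ≤ c * M := by
  have hden : 0 < 1 - 2 * q := by linarith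
  have hnum : |(1 - q) * f s - q * f (-s)| ≤ M := by
    have h1 : 0 ≤ 1 - q := by linarith
    calc |(1 - q) * f s - q * f (-s)| ≤ |(1 - q) * f s| + |q * f (-s)| := abs_sub _ _
      _ = (1 - q) * |f s| + q * |f (-s)| := by
          rw [abs_mul, abs_mul, abs_of_nonneg h0, abs_of_nonneg h1]
      _ ≤ (1 - q) * M + q * M :=
          add_le_add (mul_le_mul_of_nonneg_left (hf s) h1)
            (mul_le_mul_of_nonneg_left (hf (-s)) h0)
      _ = M := by ring
  rw [debias, abs_div, abs_of_pos hden, div_eq_inv_mul]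
  exact mul_le_mul hc hnum (abs_nonneg _) ((inv_pos.mpr hden).le.trans hc)

lemma cosh_add_mul_sinh_le_exp_mul (hc : 1 ≤ c) (x : ℝ) :
    cosh x + c * sinh x ≤ exp (c * x) := by
  have hsinh : sinh x ≤ x * exp x := by
    have hexp : exp (-x) = exp x * exp (-(2 * x)) := by
      rw [← exp_add]
      ring_nf
    have hneg := mul_le_mul_of_nonneg_left (add_one_le_exp (-(2 * x))) (exp_pos x).le
    rw [sinh_eq, hexp]
    linarith
  calc cosh x + c * sinh x = exp x + (c - 1) * sinh x := by
        rw [← cosh_add_sinh]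
        ring
    _ ≤ exp x + (c - 1) * (x * exp x) := by gcongr
    _ = exp x * ((c - 1) * x + 1) := by ring
    _ ≤ exp x * exp ((c - 1) * x) := by gcongr; exact add_one_le_exp _
    _ = exp (c * x) := by
        rw [← exp_add]
        ring_nf

lemma one_le_of_inv_le (h0 : 0 ≤ q) (hq : q < 1 / 2) (hc : (1 - 2 * q)⁻¹ ≤ c) : 1 ≤ c :=
  ((one_le_inv₀ (by linarith)).mpr (by linarith)).trans hc

/-- The general bound `abs_debias_le` would cost a factor `c` for every vertex, exponential in
their number; this one depends only on the total size of the exponents. -/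
lemma abs_debias_exp_le (h0 : 0 ≤ q) (hq : q < 1 / 2) (hc : (1 - 2 * q)⁻¹ ≤ c) (a : ℝ)
    (s : ℤˣ) : |debias q (fun t => exp (a * spin t)) s| ≤ exp (c * |a|) := by
  have hden : 0 < 1 - 2 * q := by linarith
  have habs : |a * spin s| = |a| := by rw [abs_mul, abs_spin, mul_one]
  have hdebias : debias q (fun t => exp (a * spin t)) s =
      cosh (a * spin s) + (1 - 2 * q)⁻¹ * sinh (a * spin s) := by
    rw [debias, spin_neg, mul_neg, cosh_eq, sinh_eq, div_eq_iff hden.ne', add_mul,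
      mul_right_comm, inv_mul_cancel₀ hden.ne']
    ring
  calc |debias q (fun t => exp (a * spin t)) s|
      ≤ |cosh (a * spin s)| + |(1 - 2 * q)⁻¹ * sinh (a * spin s)| :=
        hdebias ▸ abs_add_le _ _
    _ = cosh |a| + (1 - 2 * q)⁻¹ * sinh |a| := by
        rw [abs_mul, abs_sinh, abs_of_pos (cosh_pos _), abs_of_pos (inv_pos.mpr hden),
          ← cosh_abs (a * spin s), habs]
    _ ≤ cosh |a| + c * sinh |a| := by
        have := sinh_nonneg_iff.mpr (abs_nonneg a)
        gcongr
    _ ≤ exp (c * |a|) :=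
        cosh_add_mul_sinh_le_exp_mul (one_le_of_inv_le h0 hq hc) _

end Debias

section Estimator

variable {k : ℕ} {p : Fin (k + 1) → ℝ} {c r : ℝ}

/-- The factor in the spin of vertex `j` of the product `z_i exp (-r ∑ v_j z_j)`. -/
def gradFactor (v : Fin k → ℝ) (i : Fin k) (r : ℝ) (j : Fin k) (s : ℤˣ) : ℝ :=
  (if j = i then spin s else 1) * exp (-(v j * r) * spin s)

lemma gradFactor_self (v : Fin k → ℝ) (i : Fin k) (r : ℝ) :
    gradFactor v i r i = fun s => spin s * exp (-(v i * r) * spin s) := by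
  funext s
  rw [gradFactor, if_pos rfl]

lemma gradFactor_of_ne (v : Fin k → ℝ) {i j : Fin k} (h : j ≠ i) (r : ℝ) :
    gradFactor v i r j = fun s => exp (-(v j * r) * spin s) := by
  funext s
  rw [gradFactor, if_neg h, one_mul]

lemma prod_gradFactor (v : Fin k → ℝ) (i : Fin k) (r : ℝ) (z : Fin k → ℤˣ) :
    ∏ j, gradFactor v i r j (z j) = spin (z i) * exp (-(r * ∑ j, v j * spin (z j))) := by
  simp only [gradFactor, prod_mul_distrib, prod_ite_eq', mem_univ, if_true, ← exp_sum, mul_sum,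
    ← sum_neg_distrib]
  congr 2
  exact sum_congr rfl fun j _ => by ring

lemma gradFactor_neg (v : Fin k → ℝ) (i : Fin k) (r : ℝ) :
    gradFactor v i (-r) = gradFactor (-v) i r := by
  funext j s
  simp only [gradFactor, Pi.neg_apply, mul_neg, neg_mul]

lemma toBall_neg (w : Coord k → ℝ) : toBall (-w) = -toBall w := by
  funext i
  simp only [toBall, Pi.neg_apply]
  ring

lemma sigma_spin (q a : ℝ) (s : ℤˣ) :
    sigma q a (spin s) = debias q (fun t => exp (a * spin t)) s := by
  simp only [sigma, debias, spin_neg, mul_neg]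

lemma sigmaLin_spin (q a : ℝ) (s : ℤˣ) :
    sigmaLin q a (spin s) = debias q (fun t => spin t * exp (a * spin t)) s := by
  simp only [sigmaLin, debias, spin_neg, mul_neg]

lemma hFlip_eq_prod_debias (p : Fin (k + 1) → ℝ) (i : Fin k) (w : Coord k → ℝ)
    (x : Config (k + 1)) :
    hFlip p i w x = spin (x (Fin.last k)) * ∏ j, debias (p j.castSucc)
      (gradFactor (toBall w) i (spin (x (Fin.last k))) j) (x j.castSucc) := by
  rw [hFlip, mul_assoc, ← mul_prod_erase univ _ (mem_univ i), sigmaLin_spin, gradFactor_self]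
  congr 2
  exact prod_congr rfl fun j hj => by rw [sigma_spin, gradFactor_of_ne _ (ne_of_mem_erase hj)]

lemma hFlip_reverse_last (p : Fin (k + 1) → ℝ) (i : Fin k) (w : Coord k → ℝ)
    (x : Config (k + 1)) : hFlip p i w (reverse (Fin.last k) x) = -hFlip p i (-w) x := by
  simp only [hFlip_eq_prod_debias, reverse_self, reverse_of_ne (Fin.castSucc_lt_last _).ne,
    spin_neg, gradFactor_neg, toBall_neg, neg_mul]

lemma gFlip_eq_neg_debias (p : Fin (k + 1) → ℝ) (i : Fin k) (w : Coord k → ℝ)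
    (x : Config (k + 1)) :
    gFlip p i w x = -debias (p (Fin.last k))
      (fun s => hFlip p i w (Function.update x (Fin.last k) s)) (x (Fin.last k)) := by
  have hneg := hFlip_reverse_last p i w x
  rw [reverse] at hneg
  rw [gFlip, debias, Function.update_eq_self, hneg, mul_neg, sub_neg_eq_add]

lemma abs_hFlip_le (hp0 : ∀ i, 0 ≤ p i) (hp : ∀ i, p i < 1 / 2) (hc : ∀ i, (1 - 2 * p i)⁻¹ ≤ c)
    (i : Fin k) (w : Coord k → ℝ) (x : Config (k + 1)) :
    |hFlip p i w x| ≤ c * exp (c * ∑ j, |toBall w j|) := by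
  have hc1 : 1 ≤ c := one_le_of_inv_le (hp0 0) (hp 0) (hc 0)
  have hfactor : ∀ j, |debias (p j.castSucc)
      (gradFactor (toBall w) i (spin (x (Fin.last k))) j) (x j.castSucc)| ≤
      (if j = i then c else 1) * exp (c * |toBall w j|) := fun j => by
    set a := -(toBall w j * spin (x (Fin.last k))) with ha
    have habs : |a| = |toBall w j| := by rw [ha, abs_neg, abs_mul, abs_spin, mul_one]
    split_ifs with hj
    · subst hj
      refine abs_debias_le (hp0 _) (hp _) (hc _) (fun s => ?_) _
      rw [gradFactor_self, abs_mul, abs_spin, one_mul, abs_exp, exp_le_exp, ← ha]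
      refine (le_abs_self _).trans ?_
      rw [abs_mul, abs_spin, mul_one, habs]
      exact le_mul_of_one_le_left (abs_nonneg _) hc1
    · rw [gradFactor_of_ne _ hj, one_mul, ← habs]
      exact abs_debias_exp_le (hp0 _) (hp _) (hc _) a _
  rw [hFlip_eq_prod_debias, abs_mul, abs_spin, one_mul, abs_prod]
  refine (prod_le_prod (fun _ _ => abs_nonneg _) fun j _ => hfactor j).trans_eq ?_
  rw [prod_mul_distrib, prod_ite_eq', if_pos (mem_univ i), ← exp_sum, mul_sum]

theorem abs_gFlip_le (hp0 : ∀ i, 0 ≤ p i) (hp : ∀ i, p i < 1 / 2)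
    (hc : ∀ i, (1 - 2 * p i)⁻¹ ≤ c) {w : Coord k → ℝ} (hw : ∑ j, |toBall w j| ≤ r)
    (x : Config (k + 1)) (i : Fin k) : |gFlip p i w x| ≤ c ^ 2 * exp (c * r) := by
  have hc0 : 0 ≤ c := zero_le_one.trans (one_le_of_inv_le (hp0 0) (hp 0) (hc 0))
  rw [gFlip_eq_neg_debias, abs_neg, sq, mul_assoc]
  refine abs_debias_le (hp0 _) (hp _) (hc _) (fun s => (abs_hFlip_le hp0 hp hc i w _).trans ?_) _
  gcongr

lemma integral_pi_prod_castSucc {Ω : Fin (k + 1) → Type*} [∀ i, MeasurableSpace (Ω i)]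
    (μ : ∀ i, Measure (Ω i)) [∀ i, IsProbabilityMeasure (μ i)] (f : ∀ j : Fin k, Ω j.castSucc → ℝ) :
    ∫ x, ∏ j : Fin k, f j (x j.castSucc) ∂Measure.pi μ =
      ∏ j : Fin k, ∫ y, f j y ∂μ j.castSucc := by
  have h := integral_fintype_prod_eq_prod (μ := μ)
    (Fin.lastCases (motive := fun i => Ω i → ℝ) (fun _ => 1) f)
  simpa only [Fin.prod_univ_castSucc, Fin.lastCases_castSucc, Fin.lastCases_last, mul_one,
    integral_const, probReal_univ, smul_eq_mul] using h

lemma integral_flips_hFlip (hp0 : ∀ i, 0 ≤ p i) (hp : ∀ i, p i < 1 / 2) (i : Fin k)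
    (w : Coord k → ℝ) (z : Config (k + 1)) :
    ∫ c, hFlip p i w (Function.update (c * z) (Fin.last k) (z (Fin.last k)))
        ∂Measure.pi (fun j => rad (1 - p j)) =
      spin (z (Fin.last k)) * spin (z i.castSucc) * exp (-interaction (toBall w) z) := by
  have := isProbabilityMeasure_flip hp0 hp
  simp only [hFlip_eq_prod_debias, Function.update_self,
    Function.update_of_ne (Fin.castSucc_lt_last _).ne, Pi.mul_apply]
  rw [integral_const_mul, integral_pi_prod_castSucc (fun j => rad (1 - p j)) fun j s =>
    debias (p j.castSucc) (gradFactor (toBall w) i (spin (z (Fin.last k))) j) (s * z j.castSucc)]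
  simp only [integral_debias (hp0 _) ((hp _).le.trans one_half_lt_one.le) (hp _).ne]
  rw [prod_gradFactor _ _ _ fun j => z j.castSucc, ← mul_assoc]
  rfl

lemma integral_flips_gFlip (hp0 : ∀ i, 0 ≤ p i) (hp : ∀ i, p i < 1 / 2) (i : Fin k)
    (w : Coord k → ℝ) (z : Config (k + 1)) :
    ∫ c, gFlip p i w (c * z) ∂Measure.pi (fun j => rad (1 - p j)) =
      -(spin (z (Fin.last k)) * spin (z i.castSucc) * exp (-interaction (toBall w) z)) := by
  have := isProbabilityMeasure_flip hp0 hp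
  have hupdate : ∀ (c : Config (k + 1)) s, Function.update c (Fin.last k) s * z =
      Function.update (c * z) (Fin.last k) (s * z (Fin.last k)) := fun c s => by
    conv_lhs => rw [← Function.update_eq_self (Fin.last k) z]
    rw [← Function.update_mul]
  rw [integral_pi_eq_integral_integral_update (Fin.last k) .of_finite,
    ← integral_flips_hFlip hp0 hp, ← integral_neg]
  congr 1 with c
  simp only [hupdate, gFlip_eq_neg_debias, Function.update_idem, Function.update_self, integral_neg]
  rw [integral_debias (hp0 _) ((hp _).le.trans one_half_lt_one.le) (hp _).ne]

theorem integral_gFlip (A : Matrix (Fin (k + 1)) (Fin (k + 1)) ℝ) (hp0 : ∀ i, 0 ≤ p i)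
    (hp : ∀ i, p i < 1 / 2) (w : Coord k → ℝ) (i : Fin k) :
    ∫ x, gFlip p i w x ∂flipped A 0 p = screeningGrad A (toBall w) i := by
  have := isProbabilityMeasure_flip hp0 hp
  rw [flipped, integral_map Measurable.of_discrete.aemeasurable .of_discrete,
    integral_prod _ .of_finite, screeningGrad]
  exact integral_congr_ae (ae_of_all _ fun z => integral_flips_gFlip hp0 hp i w z)

end Estimator

/-! ### The martingale of gradient noise -/

section Noise

variable {k T : ℕ} (A : Matrix (Fin (k + 1)) (Fin (k + 1)) ℝ) (p : Fin (k + 1) → ℝ)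
  (lam η : ℝ) {B : ℝ}

lemma smgIter_congr {x x' : Fin T → Config (k + 1)} {t : ℕ}
    (h : ∀ s : Fin T, s.val < t → x s = x' s) :
    smgIter p lam η x t = smgIter p lam η x' t := by
  induction t with
  | zero => rfl
  | succ t ih =>
    rw [smgIter, smgIter, ih fun s hs => h s (hs.trans t.lt_succ_self)]
    split_ifs with ht
    · rw [h ⟨t, ht⟩ t.lt_succ_self]
    · rfl

lemma smgIter_update_of_le {t s : Fin T} (h : t ≤ s) (x : Fin T → Config (k + 1))
    (y : Config (k + 1)) :
    smgIter p lam η (Function.update x s y) t = smgIter p lam η x t :=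
  smgIter_congr p lam η fun _ hr =>
    Function.update_of_ne (Fin.lt_def.mpr (hr.trans_le h)).ne _ _

/-- The contribution of round `t` to the difference between the regret against `lastRow A` measured
with the true gradients and the one measured with the estimated gradients. As a function of the
samples it is a martingale difference. -/
def noise (t : Fin T) (x : Fin T → Config (k + 1)) : ℝ :=
  ∑ i, (toBall (smgIter p lam η x t) i - lastRow A i) *
    (screeningGrad A (toBall (smgIter p lam η x t)) i - gFlip p i (smgIter p lam η x t) (x t))

lemma noise_update_of_lt {t s : Fin T} (h : t < s) (x : Fin T → Config (k + 1))
    (y : Config (k + 1)) :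
    noise A p lam η t (Function.update x s y) = noise A p lam η t x := by
  rw [noise, noise, smgIter_update_of_le p lam η h.le, Function.update_of_ne h.ne]

variable {p}

lemma integral_noise_update (hp0 : ∀ i, 0 ≤ p i) (hp : ∀ i, p i < 1 / 2) (t : Fin T)
    (x : Fin T → Config (k + 1)) :
    ∫ y, noise A p lam η t (Function.update x t y) ∂flipped A 0 p = 0 := by
  have := isProbabilityMeasure_flipped A 0 hp0 hp
  simp only [noise, smgIter_update_of_le p lam η le_rfl, Function.update_self]
  rw [integral_finsetSum _ fun _ _ => Integrable.of_finite]
  refine sum_eq_zero fun i _ => ?_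
  rw [integral_const_mul, integral_sub (integrable_const _) Integrable.of_finite, integral_const,
    integral_gFlip A hp0 hp, probReal_univ, one_smul, sub_self, mul_zero]

variable {A} {lam η}

lemma abs_screeningGrad_le (A : Matrix (Fin (k + 1)) (Fin (k + 1)) ℝ) (hp0 : ∀ i, 0 ≤ p i)
    (hp : ∀ i, p i < 1 / 2) {w : Coord k → ℝ} {i : Fin k} (hg : ∀ x, |gFlip p i w x| ≤ B) :
    |screeningGrad A (toBall w) i| ≤ B := by
  have := isProbabilityMeasure_flipped A 0 hp0 hp
  rw [← integral_gFlip A hp0 hp w i]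
  simpa only [probReal_univ, mul_one, Real.norm_eq_abs] using
    norm_integral_le_of_norm_le_const (μ := flipped A 0 p) (f := gFlip p i w) (.of_forall hg)

lemma abs_noise_le (hB : 0 ≤ B) (hp0 : ∀ i, 0 ≤ p i) (hp : ∀ i, p i < 1 / 2)
    {x : Fin T → Config (k + 1)} {t : Fin T} (hw : smgIter p lam η x t ∈ openSimplex (Coord k) lam)
    (hg : ∀ x' i, |gFlip p i (smgIter p lam η x t) x'| ≤ B)
    (hrow : ∑ i, |lastRow A i| ≤ lam) :
    |noise A p lam η t x| ≤ 4 * lam * B := by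
  rw [noise]
  set w := smgIter p lam η x t
  have hgrad (i : Fin k) : |screeningGrad A (toBall w) i - gFlip p i w (x t)| ≤ 2 * B :=
    (abs_sub _ _).trans <| by
      linarith [abs_screeningGrad_le A hp0 hp fun x' => hg x' i, hg (x t) i]
  calc _ ≤ ∑ i, (|toBall w i| + |lastRow A i|) * (2 * B) := by
        refine (abs_sum_le_sum_abs _ _).trans (sum_le_sum fun i _ => ?_)
        rw [abs_mul]
        exact mul_le_mul (abs_sub _ _) (hgrad i) (abs_nonneg _) (by positivity)
    _ = (∑ i, |toBall w i| + ∑ i, |lastRow A i|) * (2 * B) := by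
        rw [← sum_mul, sum_add_distrib]
    _ ≤ (lam + lam) * (2 * B) := by
        gcongr
        exact sum_abs_toBall_le hw
    _ = 4 * lam * B := by ring

end Noise

/-! ### From regret to the estimation error -/

section Recovery

variable {k T : ℕ} {A : Matrix (Fin (k + 1)) (Fin (k + 1)) ℝ} {p : Fin (k + 1) → ℝ}
  {lam η B : ℝ}

lemma sum_abs_lastRow_le (h : ∑ j, |A (Fin.last k) j| ≤ lam) : ∑ i, |lastRow A i| ≤ lam := by
  rw [Fin.sum_univ_castSucc] at h
  exact (le_add_of_nonneg_right (abs_nonneg _)).trans h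

lemma toBall_smgOutput (p : Fin (k + 1) → ℝ) (lam η : ℝ) (x : Fin T → Config (k + 1))
    (i : Fin k) :
    toBall (smgOutput p lam η x) i = (∑ t : Fin T, toBall (smgIter p lam η x t) i) / T := by
  simp only [toBall, smgOutput]
  rw [← mul_sub, ← sum_sub_distrib, sum_range, one_div_mul_eq_div]

lemma abs_toBall_smgOutput_le (hlam : 0 < lam) (x : Fin T → Config (k + 1))
    (hw : ∀ t, smgIter p lam η x t ∈ openSimplex (Coord k) lam) (i : Fin k) :
    |toBall (smgOutput p lam η x) i| ≤ lam := by
  have hiter (t : Fin T) : |toBall (smgIter p lam η x t) i| ≤ lam :=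
    (single_le_sum (f := fun j => |toBall (smgIter p lam η x t) j|)
      (fun _ _ => abs_nonneg _) (mem_univ i)).trans (sum_abs_toBall_le (hw t))
  rw [toBall_smgOutput, abs_div, Nat.abs_cast]
  refine div_le_of_le_mul₀ T.cast_nonneg hlam.le ((abs_sum_le_sum_abs _ _).trans ?_)
  simpa only [card_univ, Fintype.card_fin, nsmul_eq_mul, mul_comm lam] using
    sum_le_card_nsmul univ _ lam fun t _ => hiter t

lemma mul_sq_toBall_smgOutput_sub_le (p : Fin (k + 1) → ℝ) (lam η : ℝ)
    (x : Fin T → Config (k + 1)) (i : Fin k) (a : ℝ) :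
    T * (toBall (smgOutput p lam η x) i - a) ^ 2 ≤
      ∑ t : Fin T, (toBall (smgIter p lam η x t) i - a) ^ 2 := by
  obtain rfl | hT := T.eq_zero_or_pos
  · simp only [Nat.cast_zero, zero_mul, univ_eq_empty, sum_empty, le_refl]
  have hT' : (0 : ℝ) < T := Nat.cast_pos.mpr hT
  have hmean : toBall (smgOutput p lam η x) i - a =
      (∑ t : Fin T, (toBall (smgIter p lam η x t) i - a)) / T := by
    rw [toBall_smgOutput, sum_sub_distrib, sum_const, card_univ, Fintype.card_fin, nsmul_eq_mul]
    field_simp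
  have hcs := sq_sum_le_card_mul_sum_sq (s := univ)
    (f := fun t : Fin T => toBall (smgIter p lam η x t) i - a)
  rw [card_univ, Fintype.card_fin] at hcs
  rw [hmean, div_pow, pow_two (T : ℝ), ← div_div, mul_div_cancel₀ _ hT'.ne', div_le_iff₀' hT']
  exact hcs

lemma sq_sub_lastRow_le (hA : A.IsSymm) (hd : ∀ i, A i i = 0) (hlam : ∀ i, ∑ j, |A i j| ≤ lam)
    (v : Fin k → ℝ) (i : Fin k) :
    (v i - lastRow A i) ^ 2 ≤
      2 * exp (5 * lam) * ∑ j, (v j - lastRow A j) * screeningGrad A v j := by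
  have hgap := (exp_mul_sq_le_screening_sub hA hd hlam v i).trans
    (mul_le_mul_of_nonneg_left (screening_sub_le A (lastRow A) v) zero_le_two)
  rw [exp_neg, inv_mul_le_iff₀ (exp_pos _)] at hgap
  linarith

lemma sum_mul_screeningGrad_eq (A : Matrix (Fin (k + 1)) (Fin (k + 1)) ℝ) (p : Fin (k + 1) → ℝ)
    (lam η : ℝ) (x : Fin T → Config (k + 1)) :
    ∑ t : Fin T, ∑ i, (toBall (smgIter p lam η x t) i - lastRow A i) *
        screeningGrad A (toBall (smgIter p lam η x t)) i =
      (∑ t : Fin T, ∑ i, (toBall (smgIter p lam η x t) i - lastRow A i) *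
        gFlip p i (smgIter p lam η x t) (x t)) + ∑ t : Fin T, noise A p lam η t x := by
  simp only [noise, ← sum_add_distrib, ← mul_add, add_sub_cancel]

theorem mul_sq_error_le (hA : A.IsSymm) (hd : ∀ i, A i i = 0) (hlam : 0 < lam) (hη : 0 < η)
    (hB : 0 ≤ B) (hηB : 4 * (η * B) ≤ 1)
    (hg : ∀ w ∈ openSimplex (Coord k) lam, ∀ x i, |gFlip p i w x| ≤ B)
    (hrows : ∀ i, ∑ j, |A i j| ≤ lam) (x : Fin T → Config (k + 1)) (i : Fin k) :
    T * (toBall (smgOutput p lam η x) i - lastRow A i) ^ 2 ≤ 2 * exp (5 * lam) *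
      ((lam * log (2 * k + 1) + T * (8 * lam * η ^ 2 * B ^ 2)) / η +
        ∑ t, noise A p lam η t x) := by
  have hregret : ∑ t : Fin T, ∑ j, (toBall (smgIter p lam η x t) j - lastRow A j) *
      gFlip p j (smgIter p lam η x t) (x t) ≤
        (lam * log (2 * k + 1) + T * (8 * lam * η ^ 2 * B ^ 2)) / η :=
    (le_div_iff₀' hη).mpr (smg_regret_le hlam hη.le hB hηB hg x (sum_abs_lastRow_le (hrows _)))
  calc _ ≤ ∑ t : Fin T, (toBall (smgIter p lam η x t) i - lastRow A i) ^ 2 :=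
        mul_sq_toBall_smgOutput_sub_le p lam η x i _
    _ ≤ 2 * exp (5 * lam) * ∑ t : Fin T, ∑ j, (toBall (smgIter p lam η x t) j - lastRow A j) *
        screeningGrad A (toBall (smgIter p lam η x t)) j := by
        rw [mul_sum]
        exact sum_le_sum fun t _ => sq_sub_lastRow_le hA hd hrows _ i
    _ ≤ _ := by
        rw [sum_mul_screeningGrad_eq]
        gcongr

end Recovery

/-! ### Choice of the parameters -/

section Parameters

variable {k T : ℕ} {A : Matrix (Fin (k + 1)) (Fin (k + 1)) ℝ} {p : Fin (k + 1) → ℝ}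
  {lam B K ℓ ε δ : ℝ}

lemma sum_abs_le_of_width_le {n : ℕ} {A : Matrix (Fin n) (Fin n) ℝ} {θ : Fin n → ℝ}
    (h : width A θ ≤ lam) (i : Fin n) : ∑ j, |A i j| ≤ lam :=
  calc ∑ j, |A i j| ≤ (∑ j, |A i j|) + |θ i| := le_add_of_nonneg_right (abs_nonneg _)
    _ ≤ width A θ := le_ciSup (f := fun i => (∑ j, |A i j|) + |θ i|)
      (Set.finite_range _).bddAbove i
    _ ≤ lam := h

/-- The step size for `T` rounds with gradients bounded by `B`. Up to constants, the second term
minimizes the regret bound `(lam * log (2 * k + 1) + T * (8 * lam * η ^ 2 * B ^ 2)) / η`; the first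
one keeps the iterates in the simplex. -/
def stepSize (k T : ℕ) (B : ℝ) : ℝ :=
  min (1 / (4 * B)) (√(log (2 * k + 2) / T) / (2 * B))

lemma log_two_mul_add_two_pos (k : ℕ) : 0 < log (2 * (k : ℝ) + 2) :=
  log_pos (by linarith [k.cast_nonneg (α := ℝ)])

lemma stepSize_pos (k : ℕ) (hT : 0 < T) (hB : 0 < B) : 0 < stepSize k T B := by
  have hlog := log_two_mul_add_two_pos k
  have : (0 : ℝ) < T := Nat.cast_pos.mpr hT
  exact lt_min (by positivity) (by positivity)

lemma four_mul_stepSize_mul_le (k T : ℕ) (hB : 0 < B) : 4 * (stepSize k T B * B) ≤ 1 := by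
  have h : stepSize k T B ≤ 1 / (4 * B) := min_le_left _ _
  rw [le_div_iff₀ (by positivity)] at h
  linarith

lemma stepSize_eq (hT : 0 < T) (hB : 0 < B) (h : 4 * log (2 * k + 2) ≤ T) :
    stepSize k T B = √(log (2 * k + 2) / T) / (2 * B) := by
  have hsqrt : √(log (2 * k + 2) / T) ≤ 1 / 2 := by
    rw [sqrt_le_left (by norm_num), div_le_iff₀ (Nat.cast_pos.mpr hT)]
    linarith
  refine min_eq_right ?_
  rw [div_le_div_iff₀ (by positivity) (by positivity)]
  nlinarith

lemma regret_bound_le {L L' T : ℝ} (hlam : 0 ≤ lam) (hL : 0 < L) (hL' : L' ≤ L)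
    (hB : 0 < B) (hT : 0 < T) :
    (lam * L' + T * (8 * lam * (√(L / T) / (2 * B)) ^ 2 * B ^ 2)) / (√(L / T) / (2 * B)) ≤
      6 * lam * B * √(L * T) := by
  have : 0 < √(L / T) := sqrt_pos.mpr (div_pos hL hT)
  have hTs : T * √(L / T) ^ 2 = L := by rw [sq_sqrt (div_pos hL hT).le, mul_div_cancel₀ _ hT.ne']
  have hsqrt : √(L * T) = T * √(L / T) := by
    rw [← sqrt_sq (by positivity : 0 ≤ T * √(L / T)), mul_pow, pow_two T, mul_assoc, hTs, mul_comm]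
  rw [div_le_iff₀ (by positivity), hsqrt]
  calc lam * L' + T * (8 * lam * (√(L / T) / (2 * B)) ^ 2 * B ^ 2)
      = lam * L' + 2 * lam * (T * √(L / T) ^ 2) := by field_simp; ring
    _ ≤ 3 * lam * (T * √(L / T) ^ 2) := by
        rw [hTs]
        linarith [mul_le_mul_of_nonneg_left hL' hlam]
    _ = 6 * lam * B * (T * √(L / T)) * (√(L / T) / (2 * B)) := by field_simp; ring

lemma error_bound {E T : ℝ} (hlam : 0 ≤ lam) (hT : 0 ≤ T) (hℓ : 0 ≤ ℓ)
    (hK : 40 * E * B ≤ lam * exp K) (h : lam ^ 4 * ℓ * exp (2 * K) ≤ T * ε ^ 4) :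
    2 * E * (10 * lam * B * √(2 * ℓ * T)) ≤ T * ε ^ 2 := by
  have hexp : exp (2 * K) = exp K ^ 2 := exp_nat_mul K 2
  have hroot : √(2 * ℓ * T) * (lam ^ 2 * exp K) ≤ 2 * T * ε ^ 2 := by
    refine le_of_sq_le_sq ?_ (by positivity)
    calc (√(2 * ℓ * T) * (lam ^ 2 * exp K)) ^ 2 = 2 * T * (lam ^ 4 * ℓ * exp (2 * K)) := by
          rw [mul_pow, sq_sqrt (by positivity), hexp]
          ring
      _ ≤ 2 * T * (T * ε ^ 4) := by gcongr
      _ ≤ (2 * T * ε ^ 2) ^ 2 := by linarith [sq_nonneg (T * ε ^ 2)]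
  calc 2 * E * (10 * lam * B * √(2 * ℓ * T)) = 40 * E * B * (lam * √(2 * ℓ * T)) / 2 := by ring
    _ ≤ lam * exp K * (lam * √(2 * ℓ * T)) / 2 := by gcongr
    _ = √(2 * ℓ * T) * (lam ^ 2 * exp K) / 2 := by ring
    _ ≤ T * ε ^ 2 := by linarith

lemma eight_mul_le_of_le_two_mul {T : ℝ} (hlam : 0 < lam) (hT : 0 ≤ T) (hℓ : 0 ≤ ℓ) (hε : 0 ≤ ε)
    (hεlam : ε ≤ 2 * lam) (hK : 128 ≤ exp (2 * K))
    (h : lam ^ 4 * ℓ * exp (2 * K) ≤ T * ε ^ 4) : 8 * ℓ ≤ T := by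
  have hscaled : lam ^ 4 * (ℓ * 128) ≤ lam ^ 4 * (16 * T) :=
    calc lam ^ 4 * (ℓ * 128) ≤ lam ^ 4 * (ℓ * exp (2 * K)) := by gcongr
      _ = lam ^ 4 * ℓ * exp (2 * K) := by ring
      _ ≤ T * ε ^ 4 := h
      _ ≤ T * (2 * lam) ^ 4 := by gcongr
      _ = lam ^ 4 * (16 * T) := by ring
  linarith [le_of_mul_le_mul_left hscaled (by positivity)]

lemma log_div_pos (k : ℕ) (hδ : 0 < δ) (hδ1 : δ < 1) : 0 < log (((k + 1 : ℕ) : ℝ) / δ) := by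
  refine log_pos ((one_lt_div hδ).mpr (hδ1.trans_le ?_))
  exact_mod_cast k.succ_pos

lemma log_two_mul_add_two_le (hk : 0 < k) (hδ : 0 < δ) (hδ1 : δ ≤ 1) :
    log (2 * k + 2) ≤ 2 * log (((k + 1 : ℕ) : ℝ) / δ) := by
  have hk' : (1 : ℝ) ≤ k := Nat.one_le_cast.mpr hk
  rw [← log_rpow (by positivity), rpow_ofNat]
  refine log_le_log (by positivity) ?_
  calc (2 * k + 2 : ℝ) ≤ (k + 1) ^ 2 := by nlinarith
    _ ≤ (((k + 1 : ℕ) : ℝ) / δ) ^ 2 := by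
        push_cast
        gcongr
        exact le_div_self (by positivity) hδ hδ1

end Parameters

/-! ### Accuracy with high probability -/

section Accuracy

variable {k T : ℕ} {A : Matrix (Fin (k + 1)) (Fin (k + 1)) ℝ} {p : Fin (k + 1) → ℝ}
  {lam B K ℓ ε δ : ℝ}

lemma mul_sq_error_stepSize_le (hT : 0 < T) (hA : A.IsSymm) (hd : ∀ i, A i i = 0)
    (hlam : 0 < lam) (hB : 0 < B)
    (hg : ∀ w ∈ openSimplex (Coord k) lam, ∀ x i, |gFlip p i w x| ≤ B)
    (hrows : ∀ i, ∑ j, |A i j| ≤ lam) (hℓ : log (2 * k + 2) ≤ 2 * ℓ) (hℓT : 8 * ℓ ≤ T)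
    (x : Fin T → Config (k + 1))
    (hx : ∑ t, noise A p lam (stepSize k T B) t x ≤ 4 * lam * B * √(2 * ℓ * T)) (i : Fin k) :
    T * (toBall (smgOutput p lam (stepSize k T B) x) i - lastRow A i) ^ 2 ≤
      2 * exp (5 * lam) * (10 * lam * B * √(2 * ℓ * T)) := by
  have hT' : (0 : ℝ) < T := Nat.cast_pos.mpr hT
  have hregret := regret_bound_le (L' := log (2 * k + 1)) hlam.le (log_two_mul_add_two_pos k)
    (log_le_log (by positivity) (by linarith)) hB hT'
  rw [← stepSize_eq hT hB (by linarith)] at hregret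
  have hsqrt : 6 * lam * B * √(log (2 * k + 2) * T) ≤ 6 * lam * B * √(2 * ℓ * T) := by gcongr
  refine (mul_sq_error_le hA hd hlam (stepSize_pos k hT hB) hB.le
    (four_mul_stepSize_mul_le k T hB) hg hrows x i).trans ?_
  gcongr
  linarith

lemma abs_error_le (hT : 0 < T) (hA : A.IsSymm) (hd : ∀ i, A i i = 0) (hlam : 0 < lam)
    (hB : 0 < B) (hg : ∀ w ∈ openSimplex (Coord k) lam, ∀ x i, |gFlip p i w x| ≤ B)
    (hrows : ∀ i, ∑ j, |A i j| ≤ lam) (hK : 40 * exp (5 * lam) * B ≤ lam * exp K)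
    (hK' : 128 ≤ exp (2 * K)) (hℓ : log (2 * k + 2) ≤ 2 * ℓ) (hε : 0 ≤ ε)
    (hTε : lam ^ 4 * ℓ * exp (2 * K) ≤ T * ε ^ 4) (x : Fin T → Config (k + 1))
    (hx : ∑ t, noise A p lam (stepSize k T B) t x ≤ 4 * lam * B * √(2 * ℓ * T)) (i : Fin k) :
    |toBall (smgOutput p lam (stepSize k T B) x) i - lastRow A i| ≤ ε := by
  have hℓ0 : 0 ≤ ℓ := by linarith [log_two_mul_add_two_pos k]
  obtain hεlam | hεlam := le_total (2 * lam) ε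
  · have hout := abs_toBall_smgOutput_le hlam x (smgIter_mem_openSimplex hlam
      (stepSize_pos k hT hB).le hB.le (four_mul_stepSize_mul_le k T hB) hg x) i
    have hrow : |lastRow A i| ≤ lam :=
      (single_le_sum (f := fun j => |lastRow A j|) (fun _ _ => abs_nonneg _) (mem_univ i)).trans
        (sum_abs_lastRow_le (hrows _))
    exact (abs_sub _ _).trans (by linarith)
  · have hℓT := eight_mul_le_of_le_two_mul hlam T.cast_nonneg hℓ0 hε hεlam hK' hTε
    refine abs_le_of_sq_le_sq (le_of_mul_le_mul_left ?_ (Nat.cast_pos.mpr hT)) hε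
    exact (mul_sq_error_stepSize_le hT hA hd hlam hB hg hrows hℓ hℓT x hx i).trans
      (error_bound hlam.le T.cast_nonneg hℓ0 hK hTε)

variable {Ω : Type*} [MeasurableSpace Ω] {P : Measure Ω} [IsProbabilityMeasure P]

lemma one_sub_measureReal_le_of_compl_subset {s t : Set Ω} (h : sᶜ ⊆ t) :
    1 - P.real s ≤ P.real t := by
  have hcover : P.real (s ∪ t) = 1 := by
    rw [Set.eq_univ_of_univ_subset (Set.compl_subset_iff_union.mp h).ge, probReal_univ]
  linarith [measureReal_union_le (μ := P) s t]

lemma measureReal_sum_noise_ge_le {η : ℝ} (hT : 0 < T) (hp0 : ∀ i, 0 ≤ p i)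
    (hp : ∀ i, p i < 1 / 2) (hlam : 0 < lam) (hη : 0 ≤ η) (hB : 0 < B) (hηB : 4 * (η * B) ≤ 1)
    (hg : ∀ w ∈ openSimplex (Coord k) lam, ∀ x i, |gFlip p i w x| ≤ B)
    (hrow : ∑ i, |lastRow A i| ≤ lam) (hℓ : 0 ≤ ℓ) {X : Fin T → Ω → Config (k + 1)}
    (hX : ∀ t, HasLaw (X t) (flipped A 0 p) P) (hind : iIndepFun X P) :
    P.real {ω | 4 * lam * B * √(2 * ℓ * T) ≤ ∑ t, noise A p lam η t fun s => X s ω} ≤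
      exp (-ℓ) := by
  have := isProbabilityMeasure_flipped A 0 hp0 hp
  have : (0 : ℝ) < T := Nat.cast_pos.mpr hT
  have hnoise (t : Fin T) (x : Fin T → Config (k + 1)) :
      |noise A p lam η t x| ≤ NNReal.mk (4 * lam * B) (by positivity) :=
    have hw := smgIter_mem_openSimplex hlam hη hB.le hηB hg x t
    abs_noise_le hB.le hp0 hp hw (hg _ hw) hrow
  refine (measureReal_sum_ge_le_of_predictable (fun _ => Measurable.of_discrete) hnoise
    (fun t s h x y => noise_update_of_lt A p lam η h x y)
    (integral_noise_update A lam η hp0 hp) hX hind (by positivity)).trans_eq ?_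
  rw [mul_pow, sq_sqrt (by positivity), NNReal.coe_mk, Fintype.card_fin]
  congr 1
  field_simp

theorem one_sub_le_measureReal_abs_error_le (hT : 0 < T) (hA : A.IsSymm) (hd : ∀ i, A i i = 0)
    (hp0 : ∀ i, 0 ≤ p i) (hp : ∀ i, p i < 1 / 2) (hlam : 0 < lam) (hB : 0 < B)
    (hg : ∀ w ∈ openSimplex (Coord k) lam, ∀ x i, |gFlip p i w x| ≤ B)
    (hrows : ∀ i, ∑ j, |A i j| ≤ lam) (hK : 40 * exp (5 * lam) * B ≤ lam * exp K)
    (hK' : 128 ≤ exp (2 * K)) (hε : 0 ≤ ε) (hδ : 0 < δ) (hδ1 : δ < 1)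
    (hTε : lam ^ 4 * log (((k + 1 : ℕ) : ℝ) / δ) * exp (2 * K) ≤ T * ε ^ 4)
    {X : Fin T → Ω → Config (k + 1)} (hX : ∀ t, HasLaw (X t) (flipped A 0 p) P)
    (hind : iIndepFun X P) :
    1 - δ ≤ P.real {ω | ∀ i : Fin k,
      |toBall (smgOutput p lam (stepSize k T B) fun t => X t ω) i - lastRow A i| ≤ ε} := by
  have htail := measureReal_sum_noise_ge_le hT hp0 hp hlam (stepSize_pos k hT hB).le hB
    (four_mul_stepSize_mul_le k T hB) hg (sum_abs_lastRow_le (hrows _))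
    (log_div_pos k hδ hδ1).le hX hind
  have hexp : exp (-log (((k + 1 : ℕ) : ℝ) / δ)) ≤ δ := by
    rw [← log_inv, inv_div, exp_log (by positivity)]
    exact div_le_self hδ.le (by exact_mod_cast k.succ_pos)
  refine (sub_le_sub_left (htail.trans hexp) 1).trans
    (one_sub_measureReal_le_of_compl_subset fun ω hω i => ?_)
  exact abs_error_le hT hA hd hlam hB hg hrows hK hK'
    (log_two_mul_add_two_le i.pos hδ hδ1.le) hε hTε _ (le_of_not_ge hω) i

lemma exists_rate {c lam₀ : ℝ} (hc : 0 < c) (hlam₀ : 0 < lam₀) :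
    ∃ C : ℝ, 0 < C ∧ ∀ lam, lam₀ ≤ lam →
      40 * exp (5 * lam) * (c ^ 2 * exp (c * lam)) ≤ lam * exp (C * lam) ∧
        128 ≤ exp (2 * (C * lam)) := by
  set D := 40 * c ^ 2 / lam₀ ^ 2 + 128 / lam₀ with hD
  refine ⟨5 + c + D, by positivity, fun lam hlam => ?_⟩
  have hlam0 : 0 < lam := hlam₀.trans_le hlam
  have hDlam : 40 * c ^ 2 / lam₀ + 128 ≤ D * lam :=
    calc 40 * c ^ 2 / lam₀ + 128 = D * lam₀ := by rw [hD]; field_simp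
      _ ≤ D * lam := by gcongr
  have hpos : 0 < 40 * c ^ 2 / lam₀ := by positivity
  constructor
  · have hcexp : 40 * c ^ 2 ≤ lam * exp (D * lam) :=
      calc 40 * c ^ 2 = lam₀ * (40 * c ^ 2 / lam₀) := by field_simp
        _ ≤ lam * exp (D * lam) := by
            gcongr
            linarith [add_one_le_exp (D * lam)]
    calc 40 * exp (5 * lam) * (c ^ 2 * exp (c * lam))
        = exp (5 * lam) * exp (c * lam) * (40 * c ^ 2) := by ring
      _ ≤ exp (5 * lam) * exp (c * lam) * (lam * exp (D * lam)) := by gcongr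
      _ = lam * exp ((5 + c + D) * lam) := by
          rw [add_mul (5 + c), add_mul 5, exp_add, exp_add]
          ring
  · have hrate : D * lam ≤ (5 + c + D) * lam := by
      gcongr
      linarith
    linarith [add_one_le_exp (2 * ((5 + c + D) * lam))]

end Accuracy

end

end FlipIsing

open FlipIsing

theorem mainTheorem2
    (pmax : ℝ) (hpmax : pmax < 1 / 2) (lam₀ : ℝ) (hlam₀ : 0 < lam₀) :
    ∃ C : ℝ, 0 < C ∧
      ∀ (k : ℕ) (p : Fin (k + 1) → ℝ), (∀ i, 0 ≤ p i ∧ p i ≤ pmax) →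
      ∀ lam : ℝ, lam₀ ≤ lam →
      ∀ T : ℕ, ∃ η : ℝ, 0 < η ∧
        ∀ ε δ : ℝ, 0 < ε → 0 < δ → δ < 1 →
        lam ^ 4 * Real.log (((k + 1 : ℕ) : ℝ) / δ) * Real.exp (C * lam) * ε⁻¹ ^ 4 ≤ (T : ℝ) →
        ∀ A : Matrix (Fin (k + 1)) (Fin (k + 1)) ℝ,
          A.IsSymm → (∀ i, A i i = 0) → FlipIsing.width A 0 ≤ lam →
        ∀ (Ω : Type*) [MeasurableSpace Ω] (P : Measure Ω) [IsProbabilityMeasure P]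
          (X : Fin T → Ω → FlipIsing.Config (k + 1)),
          (∀ t, HasLaw (X t) (FlipIsing.flipped A 0 p) P) → iIndepFun X P →
          1 - δ ≤ P.real {ω | ∀ i : Fin k,
            |FlipIsing.toBall (FlipIsing.smgOutput p lam η fun t => X t ω) i
              - A (Fin.last k) i.castSucc| ≤ ε} := by
  set c := (1 - 2 * pmax)⁻¹
  have hpm : 0 < 1 - 2 * pmax := by linarith
  obtain ⟨C, hC, hrate⟩ := exists_rate (inv_pos.mpr hpm) hlam₀
  refine ⟨2 * C, by positivity, fun k p hp lam hlam T => ?_⟩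
  have hlam0 : 0 < lam := hlam₀.trans_le hlam
  obtain rfl | hT := T.eq_zero_or_pos
  · refine ⟨1, one_pos, fun ε δ hε hδ hδ1 hTε => absurd hTε (not_le.mpr ?_)⟩
    have hlog := log_div_pos k hδ hδ1
    rw [Nat.cast_zero]
    positivity
  have hB : 0 < c ^ 2 * Real.exp (c * lam) := by positivity
  refine ⟨stepSize k T (c ^ 2 * Real.exp (c * lam)), stepSize_pos k hT hB,
    fun ε δ hε hδ hδ1 hTε A hA hd hwidth Ω _ P _ X hX hind => ?_⟩
  have hp0 i : 0 ≤ p i := (hp i).1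
  have hp_half i : p i < 1 / 2 := (hp i).2.trans_lt hpmax
  have hpc i : (1 - 2 * p i)⁻¹ ≤ c := inv_anti₀ hpm (by linarith [(hp i).2])
  refine one_sub_le_measureReal_abs_error_le hT hA hd hp0 hp_half hlam0 hB
    (fun w hw x i => abs_gFlip_le hp0 hp_half hpc (sum_abs_toBall_le hw) x i)
    (sum_abs_le_of_width_le hwidth) (hrate lam hlam).1 (hrate lam hlam).2 hε.le hδ hδ1 ?_ hX hind
  rwa [inv_pow, ← div_eq_mul_inv, div_le_iff₀ (by positivity), mul_assoc 2 C lam] at hTε
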